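/- All graphs are finite and simple. A graph $G$ is \emph{$(k,d)$-colourable} if its vertices can be coloured with $k$ colours so that every vertex has at most $d$ neighbours of its own colour; it is \emph{$(k,d)$-choosable} if, whenever each vertex $v$ is given a set $L(v)$ of exactly $k$ colours, one can choose for each vertex $v$ a colour in $L(v)$ so that every vertex has at most $d$ neighbours of its own colour. The \emph{defective chromatic number} (respectively, \emph{defective choice number}) of a class of graphs is the minimum integer $k$ for which there is an integer $d$ such that every graph in the class is $(k,d)$-colourable (respectively, $(k,d)$-choosable). Let $s\ge 2$ be an integer. Then the class of $K_{s+1}$-minor-free graphs has defective chromatic number $s$ and defective choice number $s$. Moreover, the supremum $$\delta:=\sup\left\{\frac{|E(G)|}{|V(G)|} : G \text{ is a non-empty } K_{s+1}\text{-minor-free graph}\right\}$$ is finite, and every $K_{s+1}$-minor-free graph is $(s,d)$-choosable, where $d:=\lfloor\delta(2\delta-s+1)\rfloor-s+1$ is a non-negative integer. The same statements hold with ``topological minor'' in place of ``minor'' throughout (also in the definition of $\delta$). -/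

import Mathlib

universe u

namespace DefectiveColouring

/-- `H` is a minor of `G`: there are pairwise disjoint connected (in particular non-empty) branch
sets in `G`, one for each vertex of `H`, such that adjacent vertices of `H` have an edge of `G`
between their branch sets. (Contract each branch set to a vertex in a suitable subgraph.) -/
def IsMinor {W V : Type*} (H : SimpleGraph W) (G : SimpleGraph V) : Prop :=
  ∃ B : W → Set V,
    (∀ a, (G.induce (B a)).Connected) ∧
    (∀ a b, a ≠ b → Disjoint (B a) (B b)) ∧
    (∀ a b, H.Adj a b → ∃ x ∈ B a, ∃ y ∈ B b, G.Adj x y)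

/-- `H` is a topological minor of `G`: some subdivision of `H` is a subgraph of `G`. That is, the
vertices of `H` are mapped injectively to branch vertices of `G`, and the edges of `H` are replaced
by paths of `G` between the corresponding branch vertices, where a path contains no branch vertex
other than its two ends, and the paths of two distinct edges meet only in branch vertices.
(The two orientations of an edge may use the same path, reversed; no condition relates them.) -/
def IsTopologicalMinor {W V : Type*} (H : SimpleGraph W) (G : SimpleGraph V) : Prop :=
  ∃ (f : W ↪ V) (P : ∀ a b, H.Adj a b → G.Walk (f a) (f b)),
    (∀ a b (h : H.Adj a b), (P a b h).IsPath) ∧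
    (∀ a b (h : H.Adj a b) (c : W), f c ∈ (P a b h).support → c = a ∨ c = b) ∧
    (∀ a b (h : H.Adj a b) (a' b' : W) (h' : H.Adj a' b'), s(a, b) ≠ s(a', b') →
      ∀ x, x ∈ (P a b h).support → x ∈ (P a' b' h').support → ∃ c, x = f c)

/-- Every vertex has at most `d` neighbours of its own colour. -/
def HasDefect {V α : Type*} (G : SimpleGraph V) (c : V → α) (d : ℕ) : Prop :=
  ∀ v, {w | G.Adj v w ∧ c w = c v}.encard ≤ d

/-- `G` is `(k, d)`-colourable: `k`-colourable with defect `d`. -/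
def IsColourable {V : Type*} (G : SimpleGraph V) (k d : ℕ) : Prop :=
  ∃ c : V → Fin k, HasDefect G c d

/-- `G` is `(k, d)`-choosable: for every assignment of lists of exactly `k` colours to the
vertices, there is a colouring from the lists with defect `d`. -/
def IsChoosable {V : Type u} (G : SimpleGraph V) (k d : ℕ) : Prop :=
  ∀ (α : Type u) (L : V → Finset α), (∀ v, (L v).card = k) →
    ∃ c : V → α, (∀ v, c v ∈ L v) ∧ HasDefect G c d

/-- A class of graphs. Only its finite members matter below: all graphs are finite. -/
def GraphClass := ∀ V : Type u, SimpleGraph V → Prop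

/-- The class of graphs with no `H` minor. -/
def minorFree {W : Type} (H : SimpleGraph W) : GraphClass.{u} :=
  fun _ G => ¬ IsMinor H G

/-- The class of graphs with no `H` topological minor. -/
def topologicalMinorFree {W : Type} (H : SimpleGraph W) : GraphClass.{u} :=
  fun _ G => ¬ IsTopologicalMinor H G

/-- The defective chromatic number of `C` exists and equals `k`. -/
def HasDefectiveChromaticNumber (C : GraphClass.{u}) (k : ℕ) : Prop :=
  IsLeast {j : ℕ | ∃ d : ℕ, ∀ (V : Type u) [Finite V] (G : SimpleGraph V),
    C V G → IsColourable G j d} k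

/-- The defective choice number of `C` exists and equals `k`. -/
def HasDefectiveChoiceNumber (C : GraphClass.{u}) (k : ℕ) : Prop :=
  IsLeast {j : ℕ | ∃ d : ℕ, ∀ (V : Type u) [Finite V] (G : SimpleGraph V),
    C V G → IsChoosable G j d} k

/-- The set of the densities `|E(G)| / |V(G)|` of the finite non-empty graphs `G` in `C`. -/
def densities (C : GraphClass.{u}) : Set ℝ :=
  {x | ∃ (V : Type u) (_ : Finite V) (_ : Nonempty V) (G : SimpleGraph V),
    C V G ∧ x = (G.edgeSet.ncard : ℝ) / (Nat.card V : ℝ)}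

end DefectiveColouring

/-! Both classes are handled together through `IsSuppressClosed`, which records the only closure
properties needed.

Lower bound: take a graph in which every colouring with defect `d` uses at least `s` colours, and
join an apex vertex to `d + 1` disjoint copies of it. The apex colour must be absent from some copy,
so one more colour is needed, while the largest clique minor grows by at most one
(`exists_minorFree_le_ncard_range`). Constant lists transfer the bound to choosability.

Upper bound: call a vertex high if its degree is at least `d + s`. A low vertex with too large a
defect can be given a colour that no neighbour has, so only the high vertices matter. Hence a vertex
with few high neighbours and, if it is itself high, not too many low ones is reducible: delete its
edges, colour by induction, then recolour it (`IsReducible.exists_hasDefect`). It remains to find a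
non-isolated reducible vertex in every graph of the class that has an edge.

Suppose there is none, and let `A` and `B` be the non-isolated low vertices and the high vertices.
Each vertex of `A` has `s` neighbours in `B`; they are not a clique, so suppressing the vertex adds
a new edge inside `B`. Thus `|A| + e(B) ≤ δ|B|` (`IsSuppressClosed.adjPairs_add_le`). With `e(A,B) +
e(B) ≤ δ(|A| + |B|)` and two degree counts over `B`, this is contradictory for `s ≥ 4`
(`density_inequalities_contradiction`). For `s = 2, 3`, irreducibility makes every non-isolated
vertex have degree at least `s`, which forces a cycle or a subdivided `K₄`.

Finiteness of `δ` is Mader's theorem (`isTopologicalMinorIn_of_dense`); the bound `δ ≥ s - 1` comes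
from the graphs `K_{s-1,n}`. -/

namespace DefectiveColouring

/-! ### Walks inside a vertex set. -/

/-- There is a walk of `G` from `x` to `y` all of whose vertices are in `T`. -/
def WalkIn {V : Type*} (G : SimpleGraph V) (T : Set V) (x y : V) : Prop :=
  ∃ p : G.Walk x y, ∀ z ∈ p.support, z ∈ T

section WalkIn

variable {V : Type*} {G : SimpleGraph V} {T T' : Set V} {x y z : V}

theorem WalkIn.refl (h : x ∈ T) : WalkIn G T x x :=
  ⟨.nil, by simpa using h⟩

theorem WalkIn.adj (h : G.Adj x y) (hx : x ∈ T) (hy : y ∈ T) : WalkIn G T x y :=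
  ⟨.cons h .nil, by simp [hx, hy]⟩

theorem WalkIn.symm : WalkIn G T x y → WalkIn G T y x := by
  rintro ⟨p, hp⟩
  exact ⟨p.reverse, by simpa using hp⟩

theorem WalkIn.trans : WalkIn G T x y → WalkIn G T y z → WalkIn G T x z := by
  rintro ⟨p, hp⟩ ⟨q, hq⟩
  refine ⟨p.append q, fun w hw => ?_⟩
  rw [SimpleGraph.Walk.mem_support_append_iff] at hw
  exact hw.elim (hp w) (hq w)

theorem WalkIn.mono (hT : T ⊆ T') : WalkIn G T x y → WalkIn G T' x y := by
  rintro ⟨p, hp⟩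
  exact ⟨p, fun w hw => hT (hp w hw)⟩

theorem WalkIn.left_mem : WalkIn G T x y → x ∈ T := by
  rintro ⟨p, hp⟩
  exact hp x p.start_mem_support

theorem WalkIn.right_mem : WalkIn G T x y → y ∈ T := by
  rintro ⟨p, hp⟩
  exact hp y p.end_mem_support

theorem WalkIn.induction {P : V → Prop} (h : WalkIn G T x y) (hx : P x)
    (hstep : ∀ a b, G.Adj a b → a ∈ T → b ∈ T → P a → P b) : P y := by
  obtain ⟨p, hp⟩ := h
  induction p with
  | nil => exact hx
  | cons h p ih =>
    refine ih (hstep _ _ h (hp _ (by simp)) (hp _ (by simp)) hx) fun w hw => hp w ?_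
    simp [hw]

theorem WalkIn.map {W : Type*} {H : SimpleGraph W} {S : Set W} {f : W → V} {a b : W}
    (h : WalkIn H S a b) (ha : f a ∈ T)
    (hstep : ∀ c d, H.Adj c d → c ∈ S → d ∈ S → WalkIn G T (f c) (f d)) :
    WalkIn G T (f a) (f b) :=
  h.induction (P := fun c => WalkIn G T (f a) (f c)) (.refl ha)
    fun c d hcd hc hd h => h.trans (hstep c d hcd hc hd)

/-- The set of the vertices that a vertex reaches inside `T` is connected. -/
theorem WalkIn.reachable (h : WalkIn G T x y) : WalkIn G {z | WalkIn G T x z} x y := by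
  have h' : WalkIn G {z | WalkIn G T x z} x y ∧ WalkIn G T x y := by
    refine h.induction (P := fun y => WalkIn G {z | WalkIn G T x z} x y ∧ WalkIn G T x y)
      ⟨.refl (.refl h.left_mem), .refl h.left_mem⟩ fun a b hab ha hb hP => ?_
    have hb' : WalkIn G T x b := hP.2.trans (.adj hab ha hb)
    exact ⟨hP.1.trans (.adj hab hP.2 hb'), hb'⟩
  exact h'.1

theorem WalkIn.exists_last (h : WalkIn G (insert y T) x y) (hx : x ∈ T) (hy : y ∉ T) :
    ∃ z, WalkIn G T x z ∧ G.Adj z y := by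
  obtain ⟨p, hp⟩ := h
  induction p with
  | nil => exact absurd hx hy
  | @cons a b c hab p ih =>
    by_cases hbc : b = c
    · subst hbc
      exact ⟨a, .refl hx, hab⟩
    · have hb : b ∈ T := (hp b (by simp)).resolve_left hbc
      obtain ⟨z, hz, hzc⟩ := ih hb hy fun w hw => hp w (by simp [hw])
      exact ⟨z, (WalkIn.adj hab hx hb).trans hz, hzc⟩

theorem induce_connected_iff : (G.induce T).Connected ↔
    T.Nonempty ∧ ∀ x ∈ T, ∀ y ∈ T, WalkIn G T x y := by
  constructor
  · intro h
    refine ⟨Set.nonempty_coe_sort.1 h.nonempty, fun x hx y hy => ?_⟩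
    obtain ⟨p⟩ := h.preconnected ⟨x, hx⟩ ⟨y, hy⟩
    have hp : WalkIn (G.induce T) Set.univ ⟨x, hx⟩ ⟨y, hy⟩ := ⟨p, fun _ _ => trivial⟩
    exact hp.map (f := Subtype.val) hx fun c d hcd _ _ => .adj hcd c.2 d.2
  · rintro ⟨hT, h⟩
    have := hT.to_subtype
    refine ⟨fun x y => ?_⟩
    obtain ⟨p, hp⟩ := h x x.2 y y.2
    exact ⟨p.induce T hp⟩

theorem induce_connected_of_root (hx : x ∈ T) (h : ∀ y ∈ T, WalkIn G T x y) :
    (G.induce T).Connected :=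
  induce_connected_iff.2 ⟨⟨x, hx⟩, fun y hy z hz => (h y hy).symm.trans (h z hz)⟩

end WalkIn

/-! ### Minors and topological minors. -/

section TopologicalMinor

variable {W V : Type*} {H : SimpleGraph W} {G : SimpleGraph V}

/-- Shortcutting a walk to a path keeps it inside its region, so disjoint regions for the path
interiors suffice. With the converse `IsTopologicalMinor.exists_walkIn`, this replaces paths by
walks throughout. -/
theorem isTopologicalMinor_of_forall_walkIn (f : W ↪ V) (S : Sym2 W → Set V)
    (hf : ∀ e c, f c ∉ S e) (hS : ∀ e e', e ≠ e' → Disjoint (S e) (S e'))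
    (h : ∀ a b, H.Adj a b → WalkIn G (S s(a, b) ∪ {f a, f b}) (f a) (f b)) :
    IsTopologicalMinor H G := by
  classical
  choose p hp using h
  have hp' : ∀ a b h, ∀ z ∈ (p a b h).bypass.support, z ∈ S s(a, b) ∪ {f a, f b} :=
    fun a b h z hz => hp a b h z ((p a b h).support_bypass_subset_support hz)
  refine ⟨f, fun a b h => (p a b h).bypass, fun a b h => (p a b h).bypass_isPath,
    fun a b h c hc => ?_, fun a b h a' b' h' hne x hx hx' => ?_⟩
  · rcases hp' a b h _ hc with h1 | h1 | h1
    · exact absurd h1 (hf _ _)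
    · exact .inl (f.injective h1)
    · exact .inr (f.injective h1)
  · rcases hp' a b h _ hx with h1 | h1 | h1
    · rcases hp' a' b' h' _ hx' with h2 | h2 | h2
      · exact absurd h2 ((hS _ _ hne).notMem_of_mem_left h1)
      · exact ⟨_, h2⟩
      · exact ⟨_, h2⟩
    · exact ⟨_, h1⟩
    · exact ⟨_, h1⟩

theorem IsTopologicalMinor.exists_walkIn (h : IsTopologicalMinor H G) :
    ∃ (f : W ↪ V) (S : Sym2 W → Set V), (∀ e c, f c ∉ S e) ∧
      (∀ e e', e ≠ e' → Disjoint (S e) (S e')) ∧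
      ∀ a b, H.Adj a b → WalkIn G (S s(a, b) ∪ {f a, f b}) (f a) (f b) := by
  obtain ⟨f, P, -, hb, hd⟩ := h
  refine ⟨f, fun e => {x | (∀ c, x ≠ f c) ∧ ∃ a b, ∃ h : H.Adj a b, e = s(a, b) ∧
    x ∈ (P a b h).support}, fun e c hc => hc.1 c rfl, fun e e' hne => ?_, fun a b h => ?_⟩
  · rw [Set.disjoint_left]
    rintro x ⟨hx, a, b, h, rfl, hxs⟩ ⟨-, a', b', h', rfl, hxs'⟩
    obtain ⟨c, hc⟩ := hd a b h a' b' h' hne x hxs hxs'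
    exact hx c hc
  · refine ⟨P a b h, fun z hz => ?_⟩
    by_cases hc : ∃ c, z = f c
    · obtain ⟨c, rfl⟩ := hc
      rcases hb a b h c hz with rfl | rfl <;> simp
    · exact .inl ⟨not_exists.1 hc, a, b, h, rfl, hz⟩

theorem IsTopologicalMinor.map {U : Type*} {G' : SimpleGraph U} (h : IsTopologicalMinor H G)
    (g : V ↪ U) (hg : ∀ x y, G.Adj x y → G'.Adj (g x) (g y)) : IsTopologicalMinor H G' := by
  obtain ⟨f, S, hf, hS, hw⟩ := h.exists_walkIn
  refine isTopologicalMinor_of_forall_walkIn (f.trans g) (fun e => g '' S e) ?_ ?_ ?_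
  · rintro e c ⟨x, hx, hxc⟩
    exact hf e c (g.injective hxc ▸ hx)
  · exact fun e e' hne => Set.disjoint_image_of_injective g.injective (hS e e' hne)
  · intro a b hab
    have hmem : ∀ z ∈ S s(a, b) ∪ {f a, f b},
        g z ∈ g '' S s(a, b) ∪ {(f.trans g) a, (f.trans g) b} := by
      rintro z (hz | rfl | rfl)
      · exact .inl ⟨z, hz, rfl⟩
      · simp
      · simp
    exact (hw a b hab).map (f := g) (hmem _ (hw a b hab).left_mem)
      fun c d hcd hc hd => .adj (hg _ _ hcd) (hmem c hc) (hmem d hd)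

theorem IsMinor.map {U : Type*} {G' : SimpleGraph U} (h : IsMinor H G)
    (g : V ↪ U) (hg : ∀ x y, G.Adj x y → G'.Adj (g x) (g y)) : IsMinor H G' := by
  obtain ⟨B, hc, hd, ha⟩ := h
  refine ⟨fun a => g '' B a, fun a => ?_, fun a b hab =>
    Set.disjoint_image_of_injective g.injective (hd a b hab), fun a b hab => ?_⟩
  · obtain ⟨⟨x, hx⟩, hw⟩ := induce_connected_iff.1 (hc a)
    refine induce_connected_of_root (Set.mem_image_of_mem g hx) ?_
    rintro _ ⟨y, hy, rfl⟩
    exact (hw x hx y hy).map (Set.mem_image_of_mem g hx) fun c d hcd hc hd =>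
      .adj (hg _ _ hcd) (Set.mem_image_of_mem g hc) (Set.mem_image_of_mem g hd)
  · obtain ⟨x, hx, y, hy, hxy⟩ := ha a b hab
    exact ⟨g x, Set.mem_image_of_mem g hx, g y, Set.mem_image_of_mem g hy, hg _ _ hxy⟩

/-- A topological minor is a minor: each branch vertex takes the interiors of the paths that go
to later branch vertices. -/
theorem IsTopologicalMinor.isMinor [LinearOrder W] (h : IsTopologicalMinor H G) :
    IsMinor H G := by
  obtain ⟨f, S, hf, hS, hw⟩ := h.exists_walkIn
  -- The part of the interior of the path `ab` that is attached to `f a`. It is used only for `a <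
  -- b`, so each interior is claimed by one end.
  let R : W → W → Set V := fun a b => {z | WalkIn G (insert (f a) (S s(a, b))) (f a) z}
  have hR : ∀ a b, R a b ⊆ insert (f a) (S s(a, b)) := fun a b z hz => hz.right_mem
  have hroot : ∀ a b, f a ∈ R a b := fun a b => .refl (Set.mem_insert _ _)
  let B : W → Set V := fun a => insert (f a) {z | ∃ b, a < b ∧ z ∈ R a b}
  have hsub : ∀ a b, a < b → R a b ⊆ B a := fun a b hab z hz => .inr ⟨b, hab, hz⟩
  have hadj : ∀ a b, a < b → H.Adj a b → ∃ x ∈ B a, ∃ y ∈ B b, G.Adj x y := by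
    intro a b hab hH
    have h1 : WalkIn G (insert (f b) (insert (f a) (S s(a, b)))) (f a) (f b) := by
      refine (hw a b hH).mono ?_
      rintro z (hz | rfl | rfl)
      · exact .inr (.inr hz)
      · simp
      · simp
    obtain ⟨z, hz, hzb⟩ := h1.exists_last (Set.mem_insert _ _) (by
      rintro (h2 | h2)
      · exact hab.ne' (f.injective h2)
      · exact hf _ _ h2)
    exact ⟨z, hsub a b hab hz, f b, Set.mem_insert _ _, hzb⟩
  refine ⟨B, fun a => ?_, fun a b hab => ?_, fun a b hab => ?_⟩
  · refine induce_connected_of_root (Set.mem_insert _ _) ?_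
    rintro y (rfl | ⟨b, hab, hy⟩)
    · exact .refl (Set.mem_insert _ _)
    · exact hy.reachable.mono (hsub a b hab)
  · rw [Set.disjoint_left]
    have hB : ∀ a, ∀ z ∈ B a, z = f a ∨ ∃ b, a < b ∧ z ∈ S s(a, b) := by
      rintro a z (rfl | ⟨b, hab, hz⟩)
      · exact .inl rfl
      · exact (hR a b hz).imp id fun h => ⟨b, hab, h⟩
    intro z hza hzb
    rcases hB a z hza with rfl | ⟨c, hac, hc⟩
    · rcases hB b _ hzb with h1 | ⟨d, _, hd⟩
      · exact hab (f.injective h1)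
      · exact hf _ _ hd
    · rcases hB b z hzb with rfl | ⟨d, hbd, hd⟩
      · exact hf _ _ hc
      · refine (hS s(a, c) s(b, d) ?_).notMem_of_mem_left hc hd
        rw [Ne, Sym2.eq_iff]
        rintro (⟨h1, -⟩ | ⟨h1, h2⟩)
        · exact hab h1
        · subst h1 h2
          exact lt_asymm hac hbd
  · rcases hab.ne.lt_or_gt with h1 | h1
    · exact hadj a b h1 hab
    · obtain ⟨x, hx, y, hy, hxy⟩ := hadj b a h1 hab.symm
      exact ⟨y, hy, x, hx, hxy.symm⟩

end TopologicalMinor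

/-! ### Suppressing a vertex creates no new complete (topological) minor. -/

section Suppress

variable {V : Type*}

/-- Delete the edges at `a` and add the edge `uv`; if `u` and `v` are neighbours of `a`, this is
the deletion of the other edges at `a`, followed by the suppression of `a`. -/
def suppress (G : SimpleGraph V) (a u v : V) : SimpleGraph V where
  Adj x y := x ≠ y ∧ (G.Adj x y ∧ x ≠ a ∧ y ≠ a ∨ s(x, y) = s(u, v))
  symm := ⟨by
    rintro x y ⟨hne, h⟩
    exact ⟨hne.symm, by rwa [G.adj_comm, and_comm (a := y ≠ a), Sym2.eq_swap]⟩⟩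
  loopless := ⟨fun x h => h.1 rfl⟩

variable {G : SimpleGraph V} {a u v : V}

theorem ne_of_suppress_adj (hu : G.Adj a u) (hv : G.Adj a v) {x y : V}
    (h : (suppress G a u v).Adj x y) : x ≠ a ∧ y ≠ a := by
  rcases h.2 with h | h
  · exact h.2
  · rcases Sym2.eq_iff.1 h with ⟨rfl, rfl⟩ | ⟨rfl, rfl⟩
    · exact ⟨hu.ne', hv.ne'⟩
    · exact ⟨hv.ne', hu.ne'⟩

theorem walkIn_of_suppress (hu : G.Adj a u) (hv : G.Adj a v) {T T' : Set V} {x y : V}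
    (h : WalkIn (suppress G a u v) T x y) (hx : x ≠ a) (hT : ∀ z ∈ T, z ≠ a → z ∈ T')
    (ha : u ∈ T → v ∈ T → a ∈ T') : WalkIn G T' x y := by
  refine h.map (f := id) (hT x h.left_mem hx) fun c d hcd hc hd => ?_
  obtain ⟨hca, hda⟩ := ne_of_suppress_adj hu hv hcd
  rcases hcd.2 with h1 | h1
  · exact .adj h1.1 (hT c hc hca) (hT d hd hda)
  · rcases Sym2.eq_iff.1 h1 with ⟨rfl, rfl⟩ | ⟨rfl, rfl⟩
    · exact (WalkIn.adj hu.symm (hT _ hc hca) (ha hc hd)).trans (.adj hv (ha hc hd) (hT _ hd hda))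
    · exact (WalkIn.adj hv.symm (hT _ hc hca) (ha hd hc)).trans (.adj hu (ha hd hc) (hT _ hd hda))

variable {W : Type*}

/-- At most one path can use the edge `uv`, and rerouting it through `a` is harmless because `a` is
isolated in the suppressed graph. -/
theorem isTopologicalMinor_of_suppress [Nontrivial W] (huv : u ≠ v) (hu : G.Adj a u)
    (hv : G.Adj a v) (h : IsTopologicalMinor (⊤ : SimpleGraph W) (suppress G a u v)) :
    IsTopologicalMinor (⊤ : SimpleGraph W) G := by
  obtain ⟨f, S, hf, hS, hw⟩ := h.exists_walkIn
  have hfa : ∀ c, f c ≠ a := by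
    intro c hc
    obtain ⟨d, hd⟩ := exists_ne c
    have h1 := hw c d hd.symm
    have h2 : f d = a := h1.induction (P := fun z => z = a) hc
      fun x y hxy _ _ hx => absurd hx (ne_of_suppress_adj hu hv hxy).1
    exact hd (f.injective (h2.trans hc.symm))
  let E : Sym2 W → Set V := fun e => S e ∪ f '' {c | c ∈ e}
  -- The vertex `a` goes to the region whose closure `E e` contains both `u` and `v`. Two closures
  -- share only branch vertices, so two such edges would both have ends `u` and `v` and coincide.
  refine isTopologicalMinor_of_forall_walkIn f
    (fun e => (S e \ {a}) ∪ {z | z = a ∧ u ∈ E e ∧ v ∈ E e}) ?_ ?_ ?_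
  · rintro e c (h1 | ⟨h1, -⟩)
    · exact hf e c h1.1
    · exact hfa c h1
  · have hE : ∀ e e', e ≠ e' → ∀ z ∈ E e, z ∈ E e' → ∃ c, f c = z ∧ c ∈ e ∧ c ∈ e' := by
      rintro e e' hne z (h1 | ⟨c, hc, rfl⟩) (h2 | ⟨d, hd, h2⟩)
      · exact absurd h2 ((hS e e' hne).notMem_of_mem_left h1)
      · exact absurd (h2 ▸ h1) (hf e d)
      · exact absurd h2 (hf e' c)
      · exact ⟨c, rfl, hc, f.injective h2 ▸ hd⟩
    intro e e' hne
    rw [Set.disjoint_left]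
    rintro z (⟨h1, h1'⟩ | ⟨rfl, hu1, hv1⟩) (⟨h2, h2'⟩ | ⟨h2, hu2, hv2⟩)
    · exact (hS e e' hne).notMem_of_mem_left h1 h2
    · exact h1' h2
    · exact h2' rfl
    · obtain ⟨c, rfl, hc, hc'⟩ := hE e e' hne u hu1 hu2
      obtain ⟨d, rfl, hd, hd'⟩ := hE e e' hne v hv1 hv2
      have hcd : c ≠ d := fun h => huv (h ▸ rfl)
      exact hne (((Sym2.mem_and_mem_iff hcd).1 ⟨hc, hd⟩).trans
        ((Sym2.mem_and_mem_iff hcd).1 ⟨hc', hd'⟩).symm)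
  · intro b c hbc
    have hsub : ∀ z ∈ S s(b, c) ∪ {f b, f c}, z ∈ E s(b, c) := by
      rintro z (hz | rfl | rfl)
      · exact .inl hz
      · exact .inr ⟨b, by simp, rfl⟩
      · exact .inr ⟨c, by simp, rfl⟩
    refine walkIn_of_suppress hu hv (hw b c hbc) (hfa b) ?_ fun hu' hv' =>
      .inl (.inr ⟨rfl, hsub u hu', hsub v hv'⟩)
    rintro z (hz | hz) hza
    · exact .inl (.inl ⟨hz, hza⟩)
    · exact .inr hz

/-- Adding `a` to the branch set of `u` restores every use of the edge `uv`, whether inside one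
branch set or between two. -/
theorem isMinor_of_suppress [Nontrivial W] (hu : G.Adj a u)
    (hv : G.Adj a v) (h : IsMinor (⊤ : SimpleGraph W) (suppress G a u v)) :
    IsMinor (⊤ : SimpleGraph W) G := by
  obtain ⟨B, hc, hd, ha⟩ := h
  simp only [induce_connected_iff] at hc
  have hBa : ∀ c, a ∉ B c := by
    intro c hac
    obtain ⟨d, hd⟩ := exists_ne c
    obtain ⟨x, hx, y, hy, hxy⟩ := ha c d hd.symm
    have h2 : x = a := ((hc c).2 a hac x hx).induction (P := fun z => z = a) rfl
      fun x y hxy _ _ hx => absurd hx (ne_of_suppress_adj hu hv hxy).1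
    exact (ne_of_suppress_adj hu hv hxy).1 h2
  refine ⟨fun c => B c ∪ {z | z = a ∧ u ∈ B c}, fun c => ?_, fun c d hcd => ?_, fun c d hcd => ?_⟩
  · obtain ⟨⟨x, hx⟩, hw⟩ := hc c
    have hw' : ∀ y ∈ B c, ∀ z ∈ B c, WalkIn G (B c ∪ {z | z = a ∧ u ∈ B c}) y z :=
      fun y hy z hz => walkIn_of_suppress hu hv (hw y hy z hz) (fun h => hBa c (h ▸ hy))
        (fun w hw _ => .inl hw) fun h _ => .inr ⟨rfl, h⟩
    refine induce_connected_of_root (x := x) (.inl hx) ?_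
    rintro y (hy | ⟨rfl, hy⟩)
    · exact hw' x hx y hy
    · exact (hw' x hx u hy).trans (.adj hu.symm (.inl hy) (.inr ⟨rfl, hy⟩))
  · rw [Set.disjoint_left]
    rintro z (h1 | ⟨rfl, h1⟩) (h2 | ⟨h2, h2'⟩)
    · exact (hd c d hcd).notMem_of_mem_left h1 h2
    · exact hBa c (h2 ▸ h1)
    · exact hBa d h2
    · exact (hd c d hcd).notMem_of_mem_left h1 h2'
  · obtain ⟨x, hx, y, hy, hxy⟩ := ha c d hcd
    rcases hxy.2 with h1 | h1
    · exact ⟨x, .inl hx, y, .inl hy, h1.1⟩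
    · rcases Sym2.eq_iff.1 h1 with ⟨rfl, rfl⟩ | ⟨rfl, rfl⟩
      · exact ⟨a, .inr ⟨rfl, hx⟩, y, .inl hy, hv⟩
      · exact ⟨x, .inl hx, a, .inr ⟨rfl, hy⟩, hv.symm⟩

end Suppress

open scoped Classical

/-! ### Counting adjacent ordered pairs; an edge inside `S` counts twice in `adjPairs G S S`. -/

section Counting

variable {V : Type*} (G : SimpleGraph V)

/-- The neighbours of `v` in `S`. -/
noncomputable def nbrs (S : Finset V) (v : V) : Finset V := {w ∈ S | G.Adj v w}

/-- The number of pairs of adjacent vertices in `S ×ˢ T`. -/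
noncomputable def adjPairs (S T : Finset V) : ℕ := ∑ v ∈ S, (nbrs G T v).card

variable {G} {S T : Finset V} {v w : V}

@[simp]
theorem mem_nbrs : w ∈ nbrs G S v ↔ w ∈ S ∧ G.Adj v w := by
  simp [nbrs]

theorem nbrs_union (S T : Finset V) (v : V) : nbrs G (S ∪ T) v = nbrs G S v ∪ nbrs G T v :=
  Finset.filter_union ..

theorem card_nbrs_union (h : Disjoint S T) (v : V) :
    (nbrs G (S ∪ T) v).card = (nbrs G S v).card + (nbrs G T v).card := by
  rw [nbrs_union, Finset.card_union_of_disjoint]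
  exact Finset.disjoint_filter_filter h

theorem adjPairs_comm (S T : Finset V) : adjPairs G S T = adjPairs G T S := by
  have h := Finset.sum_card_bipartiteAbove_eq_sum_card_bipartiteBelow G.Adj (s := S) (t := T)
  simp only [Finset.bipartiteAbove, Finset.bipartiteBelow] at h
  simp only [adjPairs, nbrs, h, G.adj_comm]

theorem adjPairs_union_left {S' : Finset V} (h : Disjoint S S') (T : Finset V) :
    adjPairs G (S ∪ S') T = adjPairs G S T + adjPairs G S' T :=
  Finset.sum_union h

theorem adjPairs_union_self (h : Disjoint S T) :
    adjPairs G (S ∪ T) (S ∪ T) = adjPairs G S S + 2 * adjPairs G S T + adjPairs G T T := by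
  rw [adjPairs_union_left h, adjPairs_comm S, adjPairs_comm T, adjPairs_union_left h,
    adjPairs_union_left h, adjPairs_comm T S]
  ring

theorem adjPairs_singleton_left : adjPairs G {v} T = (nbrs G T v).card := by
  simp [adjPairs]

theorem adjPairs_singleton_self : adjPairs G {v} {v} = 0 := by
  rw [adjPairs_singleton_left, Finset.card_eq_zero, nbrs, Finset.filter_eq_empty_iff]
  simp

theorem nbrs_erase (S : Finset V) (v : V) : nbrs G (S.erase v) v = nbrs G S v := by
  ext w
  simp only [mem_nbrs, Finset.mem_erase]
  exact ⟨fun h => ⟨h.1.2, h.2⟩, fun h => ⟨⟨h.2.ne', h.1⟩, h.2⟩⟩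

theorem adjPairs_erase_add (hv : v ∈ S) :
    adjPairs G (S.erase v) (S.erase v) + 2 * (nbrs G S v).card = adjPairs G S S := by
  have h := adjPairs_union_self (G := G) (S := {v}) (T := S.erase v) (by simp)
  rw [← Finset.insert_eq, Finset.insert_erase hv, adjPairs_singleton_self,
    adjPairs_singleton_left, nbrs_erase] at h
  omega

end Counting

/-! ### Mader's theorem: excluding a topological minor bounds the density. -/

section Mader

variable {W V : Type*} {G : SimpleGraph V}

/-- `H` is a topological minor of the subgraph of `G` induced by `Z`. -/
def IsTopologicalMinorIn (H : SimpleGraph W) (G : SimpleGraph V) (Z : Finset V) : Prop :=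
  ∃ (f : W ↪ V) (S : Sym2 W → Set V), (∀ c, f c ∈ Z) ∧ (∀ e, S e ⊆ Z) ∧ (∀ e c, f c ∉ S e) ∧
    (∀ e e', e ≠ e' → Disjoint (S e) (S e')) ∧
    ∀ a b, H.Adj a b → WalkIn G (S s(a, b) ∪ {f a, f b}) (f a) (f b)

theorem IsTopologicalMinorIn.mono {H : SimpleGraph W} {Z Z' : Finset V} (hZ : Z ⊆ Z')
    (h : IsTopologicalMinorIn H G Z) : IsTopologicalMinorIn H G Z' := by
  obtain ⟨f, S, h1, h2, h3⟩ := h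
  exact ⟨f, S, fun c => hZ (h1 c), fun e => (h2 e).trans (Finset.coe_subset.2 hZ), h3⟩

/-- The vertices of `Z` outside `U` that have a neighbour in `U`. -/
noncomputable def boundary (G : SimpleGraph V) (Z U : Finset V) : Finset V :=
  {z ∈ Z \ U | ∃ u ∈ U, G.Adj u z}

/-- In a dense graph, contracting a maximal connected set that keeps the graph dense gives a set
whose neighbourhood induces a subgraph of large minimum degree. -/
theorem exists_boundary_dense (D : ℕ) (Z : Finset V) (hZ : Z.Nonempty)
    (hD : 2 * D * Z.card ≤ adjPairs G Z Z) :
    ∃ U ⊆ Z, U.Nonempty ∧ (∀ x ∈ U, ∀ y ∈ U, WalkIn G U x y) ∧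
      2 * D * ((Z \ U).card + 1) ≤ adjPairs G (Z \ U) (Z \ U) + 2 * (boundary G Z U).card ∧
      ∀ v ∈ boundary G Z U, D ≤ (nbrs G (boundary G Z U) v).card := by
  -- The inequality says that contracting `U` in `Z` leaves at least `D` edges per vertex:
  -- `boundary` counts the edges at the contracted vertex.
  let P : Finset V → Prop := fun U => U.Nonempty ∧ (∀ x ∈ U, ∀ y ∈ U, WalkIn G U x y) ∧
      2 * D * ((Z \ U).card + 1) ≤ adjPairs G (Z \ U) (Z \ U) + 2 * (boundary G Z U).card
  have hne : (Z.powerset.filter P).Nonempty := by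
    obtain ⟨u, hu⟩ := hZ
    refine ⟨{u}, ?_⟩
    have hcard := Finset.card_erase_add_one hu
    have hbd : boundary G Z {u} = nbrs G Z u := by
      ext z
      simp only [boundary, Finset.sdiff_singleton_eq_erase, Finset.mem_filter, Finset.mem_erase,
        Finset.mem_singleton, exists_eq_left, mem_nbrs]
      exact ⟨fun h => ⟨h.1.2, h.2⟩, fun h => ⟨⟨h.2.ne', h.1⟩, h.2⟩⟩
    simp only [Finset.mem_filter, Finset.mem_powerset, Finset.singleton_subset_iff, P,
      Finset.singleton_nonempty, true_and, hbd, Finset.sdiff_singleton_eq_erase, hcard,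
      adjPairs_erase_add hu]
    refine ⟨hu, ?_, hD⟩
    simp only [Finset.mem_singleton]
    rintro x rfl y rfl
    exact .refl (by simp)
  obtain ⟨U, hU, hmax⟩ := Finset.exists_max_image _ Finset.card hne
  simp only [Finset.mem_filter, Finset.mem_powerset] at hU hmax
  obtain ⟨hUZ, hUne, hUc, hUd⟩ := hU
  refine ⟨U, hUZ, hUne, hUc, hUd, fun v hv => ?_⟩
  have hv' : (v ∈ Z ∧ v ∉ U) ∧ ∃ u ∈ U, G.Adj u v := by simpa [boundary] using hv
  obtain ⟨⟨hvZ, hvU⟩, u, hu, huv⟩ := hv'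
  by_contra! hlt
  have hn : ¬ P (insert v U) := by
    intro hP
    have := hmax (insert v U) ⟨Finset.insert_subset hvZ hUZ, hP⟩
    rw [Finset.card_insert_of_notMem hvU] at this
    omega
  apply hn
  have hcoe : (U : Set V) ⊆ (insert v U : Finset V) := by simp
  have hmem : v ∈ ((insert v U : Finset V) : Set V) := by simp
  refine ⟨Finset.insert_nonempty _ _, ?_, ?_⟩
  · have hroot : ∀ x ∈ insert v U, WalkIn G (insert v U : Finset V) v x := by
      intro x hx
      rcases Finset.mem_insert.1 hx with rfl | hx
      · exact .refl hmem
      · exact (WalkIn.adj huv.symm hmem (hcoe hu)).trans ((hUc u hu x hx).mono hcoe)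
    exact fun x hx y hy => (hroot x hx).symm.trans (hroot y hy)
  -- Contracting `v` as well loses one vertex and at most one edge more than `v` has neighbours in
  -- the boundary, hence at most `D` edges.
  · have hvS : v ∈ Z \ U := Finset.mem_sdiff.2 ⟨hvZ, hvU⟩
    have hS : Z \ insert v U = (Z \ U).erase v := by
      ext z; simp only [Finset.mem_sdiff, Finset.mem_insert, Finset.mem_erase]; tauto
    have h1 := adjPairs_erase_add (G := G) hvS
    have h2 := Finset.card_erase_add_one hvS
    have h3 : (boundary G Z U).erase v ∪ (nbrs G (Z \ U) v \ nbrs G (boundary G Z U) v) ⊆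
        boundary G Z (insert v U) := by
      intro z hz
      simp only [boundary, Finset.mem_union, Finset.mem_erase, Finset.mem_filter,
        Finset.mem_sdiff, mem_nbrs, Finset.mem_insert] at hz ⊢
      rcases hz with ⟨hzv, ⟨hzZ, hzU⟩, w, hw, hwz⟩ | ⟨⟨⟨hzZ, hzU⟩, hvz⟩, -⟩
      · exact ⟨⟨hzZ, by tauto⟩, w, .inr hw, hwz⟩
      · refine ⟨⟨hzZ, ?_⟩, v, .inl rfl, hvz⟩
        rintro (rfl | h)
        · exact hvz.ne rfl
        · exact hzU h
    have h4 := Finset.card_le_card h3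
    rw [Finset.card_union_of_disjoint] at h4
    · have h5 := Finset.card_erase_add_one hv
      have h6 : nbrs G (boundary G Z U) v ⊆ nbrs G (Z \ U) v := by
        intro z hz
        simp only [boundary, Finset.mem_filter, mem_nbrs] at hz ⊢
        exact ⟨hz.1.1, hz.2⟩
      have h7 := Finset.card_sdiff_add_card_eq_card h6
      rw [hS, h2]
      have h8 : 2 * D * ((Z \ U).card + 1) = 2 * D * (Z \ U).card + 2 * D := by ring
      omega
    · rw [Finset.disjoint_left]
      intro z hz hz'
      simp only [Finset.mem_erase, Finset.mem_sdiff, mem_nbrs] at hz hz'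
      exact hz'.2 ⟨hz.2, hz'.1.2⟩

/-- Mader: every graph of large enough average degree contains a topological minor with a given
edge set. -/
theorem isTopologicalMinorIn_of_dense [Fintype W] [Nonempty W] (F : Finset (Sym2 W)) :
    ∀ Z : Finset V, Z.Nonempty →
      2 * (2 ^ F.card * Fintype.card W) * Z.card ≤ adjPairs G Z Z →
      IsTopologicalMinorIn (SimpleGraph.fromEdgeSet (F : Set (Sym2 W))) G Z := by
  induction F using Finset.induction with
  | empty =>
    intro Z hZ h
    have h1 : adjPairs G Z Z ≤ Z.card * Z.card := by
      rw [← smul_eq_mul]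
      exact Finset.sum_le_card_nsmul _ _ _ fun v _ => Finset.card_filter_le _ _
    have h2 : 2 * (2 ^ 0 * Fintype.card W) ≤ Z.card :=
      Nat.le_of_mul_le_mul_right (h.trans h1) hZ.card_pos
    obtain ⟨f⟩ : Nonempty (W ↪ Z) := by
      apply Function.Embedding.nonempty_of_card_le
      rw [Fintype.card_coe]
      omega
    exact ⟨f.trans (Function.Embedding.subtype _), fun _ => ∅, fun c => (f c).2, by simp,
      by simp, by simp, by simp⟩
  | insert e₀ F he₀ ih =>
    intro Z
    induction Z using Finset.strongInduction with
    | H Z ihZ =>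
    intro hZ h
    rw [Finset.card_insert_of_notMem he₀] at h
    obtain ⟨U, hUZ, hUne, hUc, hUd, hdeg⟩ := exists_boundary_dense _ Z hZ h
    set N := boundary G Z U with hN
    have hNZ : N ⊆ Z := fun z hz => (Finset.mem_sdiff.1 (Finset.mem_filter.1 hz).1).1
    have hNU : ∀ z ∈ N, z ∉ U := fun z hz => (Finset.mem_sdiff.1 (Finset.mem_filter.1 hz).1).2
    have hNadj : ∀ z ∈ N, ∃ u ∈ U, G.Adj u z := fun z hz => (Finset.mem_filter.1 hz).2
    -- With an empty boundary, discarding `U` keeps the density, and the inner induction on `Z`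
    -- applies. Otherwise the boundary has half the required density, enough for `F`, and `U` is
    -- free to carry the edge `e₀`.
    rcases N.eq_empty_or_nonempty with hN0 | hN0
    · rw [hN0, Finset.card_empty, mul_zero, add_zero] at hUd
      have hpos : 0 < 2 * (2 ^ (F.card + 1) * Fintype.card W) :=
        Nat.mul_pos two_pos (Nat.mul_pos (by positivity) Fintype.card_pos)
      have hne : (Z \ U).Nonempty := by
        by_contra h0
        rw [Finset.not_nonempty_iff_eq_empty] at h0
        rw [h0] at hUd
        simp only [adjPairs, Finset.sum_empty] at hUd
        simp at hUd
      refine (ihZ (Z \ U) ?_ hne ?_).mono Finset.sdiff_subset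
      · exact Finset.sdiff_ssubset hUZ hUne
      · rw [Finset.card_insert_of_notMem he₀]
        exact (Nat.mul_le_mul_left _ (Nat.le_succ _)).trans hUd
    · obtain ⟨f, S, hfN, hSN, hfS, hS, hw⟩ := ih N hN0 (by
        have := Finset.card_nsmul_le_sum N (fun v => (nbrs G N v).card) _ hdeg
        rw [smul_eq_mul] at this
        calc 2 * (2 ^ F.card * Fintype.card W) * N.card
            = N.card * (2 ^ (F.card + 1) * Fintype.card W) := by ring
          _ ≤ _ := this)
      have hUS : ∀ e, Disjoint (U : Set V) (S e) := fun e => by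
        rw [Set.disjoint_left]
        exact fun z hz hz' => hNU z (hSN e hz') hz
      refine ⟨f, Function.update S e₀ U, fun c => hNZ (hfN c), fun e => ?_, fun e c => ?_,
        fun e e' hne => ?_, fun a b hab => ?_⟩
      · rcases eq_or_ne e e₀ with rfl | he
        · simpa using hUZ
        · rw [Function.update_of_ne he]
          exact (hSN e).trans (Finset.coe_subset.2 hNZ)
      · rcases eq_or_ne e e₀ with rfl | he
        · simpa using hNU _ (hfN c)
        · rw [Function.update_of_ne he]
          exact hfS e c
      · rcases eq_or_ne e e₀ with rfl | he
        · rw [Function.update_self, Function.update_of_ne hne.symm]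
          exact hUS e'
        · rw [Function.update_of_ne he]
          rcases eq_or_ne e' e₀ with rfl | he'
          · rw [Function.update_self]
            exact (hUS e).symm
          · rw [Function.update_of_ne he']
            exact hS e e' hne
      · rcases eq_or_ne s(a, b) e₀ with he | he
        · rw [he, Function.update_self]
          obtain ⟨x, hx, hxa⟩ := hNadj _ (hfN a)
          obtain ⟨y, hy, hyb⟩ := hNadj _ (hfN b)
          exact ((WalkIn.adj hxa.symm (by simp) (.inl hx)).trans
            ((hUc x hx y hy).mono fun z hz => .inl hz)).trans
            (.adj hyb (.inl hy) (by simp))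
        · rw [Function.update_of_ne he]
          refine hw a b ?_
          simp only [SimpleGraph.fromEdgeSet_adj, Finset.coe_insert, Set.mem_insert_iff] at hab ⊢
          exact ⟨hab.1.resolve_left he, hab.2⟩

/-- Graphs with no topological minor `H` have bounded average degree. -/
theorem exists_adjPairs_lt_of_not_isTopologicalMinor [Fintype W] [Nonempty W]
    (H : SimpleGraph W) : ∃ D : ℕ, ∀ (V : Type*) (G : SimpleGraph V) (Z : Finset V), Z.Nonempty →
      ¬ IsTopologicalMinor H G → adjPairs G Z Z < 2 * D * Z.card := by
  refine ⟨2 ^ (Finset.univ : Finset (Sym2 W)).card * Fintype.card W, fun V G Z hZ hG => ?_⟩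
  by_contra! h
  obtain ⟨f, S, -, -, hf, hS, hw⟩ := isTopologicalMinorIn_of_dense Finset.univ Z hZ h
  exact hG (isTopologicalMinor_of_forall_walkIn f S hf hS fun a b hab =>
    hw a b (by simpa using hab.ne))

end Mader

/-! ### Classes closed under subgraphs and suppression. -/

/-- A class of graphs with no `K_{s+1}` topological minor that is closed under subgraphs and
under suppressing a vertex. -/
structure IsSuppressClosed (s : ℕ) (C : GraphClass.{u}) : Prop where
  map {V U : Type u} {G : SimpleGraph V} {G' : SimpleGraph U} (g : V ↪ U)
    (hg : ∀ x y, G.Adj x y → G'.Adj (g x) (g y)) : C U G' → C V G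
  suppress {V : Type u} {G : SimpleGraph V} {a u v : V} (huv : u ≠ v) (hu : G.Adj a u)
    (hv : G.Adj a v) : C V G → C V (suppress G a u v)
  not_isTopologicalMinor {V : Type u} {G : SimpleGraph V} :
    C V G → ¬ IsTopologicalMinor (⊤ : SimpleGraph (Fin (s + 1))) G

theorem IsSuppressClosed.mono {s : ℕ} {C : GraphClass.{u}} (hC : IsSuppressClosed s C)
    {V : Type u} {G G' : SimpleGraph V} (h : G ≤ G') : C V G' → C V G :=
  hC.map (.refl V) fun _ _ hxy => h hxy

theorem isSuppressClosed_topologicalMinorFree {s : ℕ} (hs : 1 ≤ s) :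
    IsSuppressClosed s (topologicalMinorFree.{u} (⊤ : SimpleGraph (Fin (s + 1)))) where
  map g hg h h' := h (h'.map g hg)
  suppress huv hu hv h h' := by
    have : Nontrivial (Fin (s + 1)) := Fin.nontrivial_iff_two_le.2 (by omega)
    exact h (isTopologicalMinor_of_suppress huv hu hv h')
  not_isTopologicalMinor h := h

theorem isSuppressClosed_minorFree {s : ℕ} (hs : 1 ≤ s) :
    IsSuppressClosed s (minorFree.{u} (⊤ : SimpleGraph (Fin (s + 1)))) where
  map g hg h h' := h (h'.map g hg)
  suppress huv hu hv h h' := by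
    have : Nontrivial (Fin (s + 1)) := Fin.nontrivial_iff_two_le.2 (by omega)
    exact h (isMinor_of_suppress hu hv h')
  not_isTopologicalMinor h h' := h h'.isMinor

theorem adjPairs_univ {V : Type*} [Fintype V] (G : SimpleGraph V) :
    adjPairs G Finset.univ Finset.univ = 2 * G.edgeSet.ncard := by
  rw [← SimpleGraph.coe_edgeFinset, Set.ncard_coe_finset, ← G.sum_degrees_eq_twice_card_edges]
  refine Finset.sum_congr rfl fun v _ => ?_
  rw [← SimpleGraph.card_neighborFinset_eq_degree]
  congr 1
  ext w
  simp

theorem adjPairs_induce {V : Type*} (G : SimpleGraph V) (Z : Finset V) :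
    adjPairs (G.induce (Z : Set V)) Finset.univ Finset.univ = adjPairs G Z Z := by
  rw [adjPairs, adjPairs, ← Finset.sum_coe_sort Z]
  refine Finset.sum_congr rfl fun v _ => ?_
  refine Finset.card_bij (fun w _ => w.1) ?_ ?_ ?_
  · intro w hw
    simp only [mem_nbrs] at hw ⊢
    exact ⟨w.2, hw.2⟩
  · exact fun w _ w' _ h => Subtype.ext h
  · intro w hw
    simp only [mem_nbrs] at hw
    exact ⟨⟨w, hw.1⟩, by simpa using hw.2, rfl⟩

/-! ### Bounds on the maximum density `δ`. -/

section Density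

variable {s : ℕ} {C : GraphClass.{u}}

theorem IsSuppressClosed.bddAbove_densities (hC : IsSuppressClosed s C) :
    BddAbove (densities C) := by
  obtain ⟨D, hD⟩ := exists_adjPairs_lt_of_not_isTopologicalMinor.{0, u}
    (⊤ : SimpleGraph (Fin (s + 1)))
  refine ⟨D, ?_⟩
  rintro x ⟨V, hV, hV', G, hG, rfl⟩
  have := Fintype.ofFinite V
  have h := hD V G Finset.univ Finset.univ_nonempty (hC.not_isTopologicalMinor hG)
  rw [adjPairs_univ, mul_assoc, mul_lt_mul_iff_right₀ two_pos, Finset.card_univ,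
    ← Nat.card_eq_fintype_card] at h
  rw [div_le_iff₀ (by exact_mod_cast Nat.card_pos)]
  exact_mod_cast h.le

theorem IsSuppressClosed.adjPairs_le (hC : IsSuppressClosed s C) {δ : ℝ}
    (hδ : δ ∈ upperBounds (densities C)) {V : Type u} {G : SimpleGraph V} (hG : C V G)
    (Z : Finset V) : (adjPairs G Z Z : ℝ) ≤ 2 * (δ * Z.card) := by
  rcases Z.eq_empty_or_nonempty with rfl | hZ
  · simp [adjPairs]
  · have : Nonempty (Z : Set V) := hZ.to_subtype
    have h := hδ ⟨(Z : Set V), inferInstance, this, G.induce (Z : Set V),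
      hC.map (.subtype _) (fun _ _ h => h) hG, rfl⟩
    rw [div_le_iff₀ (by exact_mod_cast Nat.card_pos)] at h
    rw [← adjPairs_induce, adjPairs_univ]
    have h' : Nat.card (Z : Set V) = Z.card := by simp
    rw [h'] at h
    rw [Nat.cast_mul, Nat.cast_two]
    convert mul_le_mul_of_nonneg_left h zero_le_two

/-- At most `|T|` disjoint branch sets meet the vertex cover `T`; two others would have no edge
between them. -/
theorem not_isMinor_top_of_cover {V : Type*} {G : SimpleGraph V} {k : ℕ} (T : Finset V)
    (hT : T.card + 1 < k) (h : ∀ x y, G.Adj x y → x ∈ T ∨ y ∈ T) :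
    ¬ IsMinor (⊤ : SimpleGraph (Fin k)) G := by
  rintro ⟨B, -, hd, ha⟩
  have hcard : ({c | ∃ t ∈ T, t ∈ B c} : Finset (Fin k)).card ≤ T.card := by
    have hch : ∀ c : {c // ∃ t ∈ T, t ∈ B c}, ∃ t : T, (t : V) ∈ B c := by
      rintro ⟨c, t, ht, htc⟩
      exact ⟨⟨t, ht⟩, htc⟩
    choose g hg using hch
    rw [← Fintype.card_subtype, ← Fintype.card_coe T]
    refine Fintype.card_le_of_injective g fun c c' hcc => ?_
    by_contra hne
    exact (hd c c' fun h => hne (Subtype.ext h)).notMem_of_mem_left (hg c) (hcc ▸ hg c')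
  have h2 := Finset.card_compl_add_card ({c | ∃ t ∈ T, t ∈ B c} : Finset (Fin k))
  rw [Fintype.card_fin] at h2
  obtain ⟨c, hc, c', hc', hne⟩ := Finset.one_lt_card.1 (show
    1 < ({c | ∃ t ∈ T, t ∈ B c} : Finset (Fin k))ᶜ.card by omega)
  simp only [Finset.mem_compl, Finset.mem_filter, Finset.mem_univ, true_and, not_exists,
    not_and] at hc hc'
  obtain ⟨x, hx, y, hy, hxy⟩ := ha c c' hne
  exact (h x y hxy).elim (fun hT => hc x hT hx) fun hT => hc' y hT hy

/-- The complete bipartite graph with parts `A` and its complement. -/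
def bipartiteGraph {V : Type*} (A : Finset V) : SimpleGraph V where
  Adj x y := ¬ (x ∈ A ↔ y ∈ A)
  symm := ⟨fun _ _ h h' => h h'.symm⟩
  loopless := ⟨fun _ h => h Iff.rfl⟩

theorem not_isMinor_bipartiteGraph {V : Type*} {k : ℕ} (A : Finset V) (hA : A.card + 1 < k) :
    ¬ IsMinor (⊤ : SimpleGraph (Fin k)) (bipartiteGraph A) :=
  not_isMinor_top_of_cover A hA fun x y h => by
    by_contra! h'
    exact h ⟨fun hx => absurd hx h'.1, fun hy => absurd hy h'.2⟩

theorem mul_le_ncard_edgeSet_bipartiteGraph {V : Type*} [Fintype V] (A : Finset V) :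
    A.card * (Fintype.card V - A.card) ≤ (bipartiteGraph A).edgeSet.ncard := by
  rw [← Finset.card_compl]
  have h := adjPairs_union_self (G := bipartiteGraph A) (disjoint_compl_right (a := A))
  have h2 : adjPairs (bipartiteGraph A) A Aᶜ = A.card * Aᶜ.card := by
    rw [adjPairs, Finset.sum_congr rfl (g := fun _ => Aᶜ.card), Finset.sum_const, smul_eq_mul]
    intro v hv
    rw [nbrs, Finset.filter_true_of_mem]
    intro w hw h
    exact Finset.mem_compl.1 hw (h.1 hv)
  rw [Finset.union_compl, adjPairs_univ, h2] at h
  omega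

/-- The density `(s-1)n/(s-1+n)` of `K_{s-1,n}` tends to `s - 1`, and its smaller part is a vertex
cover, so it has no `K_{s+1}` minor. -/
theorem le_of_mem_upperBounds_densities (hs : 1 ≤ s) {δ : ℝ}
    (hδ : δ ∈ upperBounds (densities C))
    (hC : ∀ (V : Type u) (G : SimpleGraph V),
      minorFree (⊤ : SimpleGraph (Fin (s + 1))) V G → C V G) :
    (s : ℝ) - 1 ≤ δ := by
  obtain ⟨t, rfl⟩ : ∃ t, s = t + 1 := ⟨s - 1, by omega⟩
  have key : ∀ n : ℕ, ((t : ℝ) * (n + 1)) ≤ δ * (t + (n + 1)) := by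
    intro n
    have hcard : Fintype.card (ULift.{u} (Fin (t + (n + 1)))) = t + (n + 1) := by simp
    obtain ⟨A, -, hA⟩ := Finset.exists_subset_card_eq
      (s := (Finset.univ : Finset (ULift.{u} (Fin (t + (n + 1)))))) (n := t)
      (by rw [Finset.card_univ]; omega)
    have hx := hδ ⟨_, inferInstance, inferInstance, bipartiteGraph A,
      hC _ _ (not_isMinor_bipartiteGraph A (by omega)), rfl⟩
    rw [div_le_iff₀ (by exact_mod_cast Nat.card_pos), Nat.card_eq_fintype_card, hcard] at hx
    have he := mul_le_ncard_edgeSet_bipartiteGraph A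
    rw [hA, hcard, Nat.add_sub_cancel_left] at he
    have he' : ((t * (n + 1) : ℕ) : ℝ) ≤ (bipartiteGraph A).edgeSet.ncard := by
      exact_mod_cast he
    push_cast at he' hx
    linarith
  by_contra! hlt
  push_cast at hlt
  have hpos : 0 < (t : ℝ) - δ := by linarith
  obtain ⟨n, hn⟩ := exists_nat_gt (δ * t / (t - δ))
  rw [div_lt_iff₀ hpos] at hn
  nlinarith [key n]

end Density

/-! ### At least `s` colours are necessary. -/

section LowerBound

/-- The graph that consists of `n` disjoint copies of `G` and a vertex adjacent to all others. -/
def apexCopies {V : Type*} (G : SimpleGraph V) (n : ℕ) : SimpleGraph (Option (Fin n × V)) where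
  Adj
    | none, none => False
    | none, some _ => True
    | some _, none => True
    | some x, some y => x.1 = y.1 ∧ G.Adj x.2 y.2
  symm := ⟨by
    rintro (_ | x) (_ | y) h
    · exact h
    · exact h
    · exact h
    · exact ⟨h.1.symm, h.2.symm⟩⟩
  loopless := ⟨by
    rintro (_ | x) h
    · exact h
    · exact h.2.ne rfl⟩

variable {V : Type*} {G : SimpleGraph V}

/-- Drop the branch set that contains the apex. The others are connected and pairwise adjacent
without it, so they lie in a single copy. -/
theorem isMinor_of_apexCopies {n s : ℕ}
    (h : IsMinor (⊤ : SimpleGraph (Fin (s + 2))) (apexCopies G n)) :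
    IsMinor (⊤ : SimpleGraph (Fin (s + 1))) G := by
  obtain ⟨B, hc, hd, ha⟩ := h
  obtain ⟨c₀, hc₀⟩ : ∃ c₀, ∀ c, c ≠ c₀ → none ∉ B c := by
    by_cases h : ∃ c, none ∈ B c
    · obtain ⟨c₀, h0⟩ := h
      exact ⟨c₀, fun c hcc h => (hd c c₀ hcc).notMem_of_mem_left h h0⟩
    -- If no branch set contains the apex, an arbitrary one is dropped.
    · exact ⟨0, fun c _ hcn => h ⟨c, hcn⟩⟩
  have hB : ∀ k : Fin (s + 1), ∃ i x, some (i, x) ∈ B (c₀.succAbove k) ∧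
      ∀ z ∈ B (c₀.succAbove k), ∃ y, z = some (i, y) ∧
        WalkIn G {y | some (i, y) ∈ B (c₀.succAbove k)} x y := by
    intro k
    have hnone := hc₀ _ (c₀.succAbove_ne k)
    obtain ⟨⟨z, hz⟩, hw⟩ := induce_connected_iff.1 (hc (c₀.succAbove k))
    rcases z with _ | ⟨i, x⟩
    · exact absurd hz hnone
    refine ⟨i, x, hz, fun w hwB => (hw _ hz w hwB).induction
      (P := fun w => ∃ y, w = some (i, y) ∧ WalkIn G {y | some (i, y) ∈ B (c₀.succAbove k)} x y)
      ⟨x, rfl, .refl hz⟩ ?_⟩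
    rintro _ b hab - hb ⟨y, rfl, hy⟩
    rcases b with _ | ⟨j, y'⟩
    · exact absurd hb hnone
    · obtain ⟨h1, h2⟩ := hab
      obtain rfl : i = j := h1
      exact ⟨y', rfl, hy.trans (.adj h2 hy.right_mem hb)⟩
  choose i x hx hwalk using hB
  have hadj : ∀ k l, k ≠ l → i k = i l ∧ ∃ y ∈ {y | some (i k, y) ∈ B (c₀.succAbove k)},
      ∃ y' ∈ {y | some (i l, y) ∈ B (c₀.succAbove l)}, G.Adj y y' := by
    intro k l hkl
    obtain ⟨z, hz, w, hw, hzw⟩ := ha _ _ fun h => hkl (Fin.succAbove_right_injective h)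
    obtain ⟨y, rfl, -⟩ := hwalk k z hz
    obtain ⟨y', rfl, -⟩ := hwalk l w hw
    exact ⟨hzw.1, y, hz, y', hw, hzw.2⟩
  have hi : ∀ k l, i k = i l := fun k l => by
    by_cases h : k = l
    · rw [h]
    · exact (hadj k l h).1
  refine ⟨fun k => {y | some (i k, y) ∈ B (c₀.succAbove k)}, fun k => ?_, fun k l hkl => ?_,
    fun k l hkl => (hadj k l hkl).2⟩
  · refine induce_connected_of_root (hx k) fun y hy => ?_
    obtain ⟨y', h1, h2⟩ := hwalk k _ hy
    simp only [Option.some.injEq, Prod.mk.injEq, true_and] at h1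
    exact h1 ▸ h2
  · rw [Set.disjoint_left]
    intro y hy hy'
    refine (hd _ _ fun h => hkl (Fin.succAbove_right_injective h)).notMem_of_mem_left hy ?_
    rw [hi k l]
    exact hy'

/-- If every copy contained the apex colour, the apex would have `d + 1` neighbours of its own
colour. -/
theorem HasDefect.exists_copy {α : Type*} {d : ℕ} {c : Option (Fin (d + 1) × V) → α}
    (h : HasDefect (apexCopies G (d + 1)) c d) :
    ∃ i, (∀ x, c (some (i, x)) ≠ c none) ∧ HasDefect G (fun x => c (some (i, x))) d := by
  obtain ⟨i, hi⟩ : ∃ i, ∀ x, c (some (i, x)) ≠ c none := by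
    by_contra! hcon
    choose x hx using hcon
    have hsub : Set.range (fun i => some (i, x i)) ⊆
        {w | (apexCopies G (d + 1)).Adj none w ∧ c w = c none} := by
      rintro _ ⟨i, rfl⟩
      exact ⟨trivial, hx i⟩
    have h1 := (Set.encard_le_encard hsub).trans (h none)
    have hinj : Function.Injective fun i : Fin (d + 1) => some (i, x i) := by
      intro i j hij
      simp only [Option.some.injEq, Prod.mk.injEq] at hij
      exact hij.1
    rw [← Set.image_univ, hinj.encard_image, Set.encard_univ, ENat.card_eq_coe_fintype_card,
      Fintype.card_fin, Nat.cast_le] at h1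
    omega
  refine ⟨i, hi, fun v => ?_⟩
  have hinj : Function.Injective fun x : V => some (i, x) := by
    intro x y hxy
    simpa using hxy
  rw [← hinj.encard_image]
  refine (Set.encard_le_encard ?_).trans (h (some (i, v)))
  rintro _ ⟨w, hw, rfl⟩
  exact ⟨⟨rfl, hw.1⟩, hw.2⟩

theorem exists_minorFree_le_ncard_range (d s : ℕ) :
    ∃ (V : Type u) (_ : Finite V) (G : SimpleGraph V),
      ¬ IsMinor (⊤ : SimpleGraph (Fin (s + 1))) G ∧
      ∀ (α : Type) (c : V → α), HasDefect G c d → s ≤ (Set.range c).ncard := by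
  induction s with
  | zero =>
    refine ⟨PEmpty, inferInstance, ⊥, ?_, fun _ _ _ => Nat.zero_le _⟩
    rintro ⟨B, hc, -⟩
    obtain ⟨x, -⟩ := (induce_connected_iff.1 (hc 0)).1
    exact x.elim
  | succ s ih =>
    obtain ⟨V, hV, G, hG, hcol⟩ := ih
    refine ⟨_, inferInstance, apexCopies G (d + 1), fun h => hG (isMinor_of_apexCopies h),
      fun α c hc => ?_⟩
    obtain ⟨i, hi, hdef⟩ := hc.exists_copy
    have h1 := hcol α _ hdef
    have h2 : c none ∉ Set.range fun x => c (some (i, x)) := by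
      rintro ⟨x, hx⟩
      exact hi x hx
    calc s + 1 ≤ (insert (c none) (Set.range fun x => c (some (i, x)))).ncard := by
          rw [Set.ncard_insert_of_notMem h2 (Set.toFinite _)]
          omega
      _ ≤ _ := by
          refine Set.ncard_le_ncard ?_ (Set.toFinite _)
          rintro _ (rfl | ⟨x, rfl⟩)
          · exact ⟨_, rfl⟩
          · exact ⟨_, rfl⟩

theorem IsChoosable.isColourable {V : Type u} {G : SimpleGraph V} {k d : ℕ}
    (h : IsChoosable G k d) : IsColourable G k d := by
  obtain ⟨c, -, hc⟩ := h (ULift.{u} (Fin k)) (fun _ => Finset.univ) fun _ => by simp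
  refine ⟨fun v => (c v).down, fun v => ?_⟩
  simpa only [ULift.down_inj] using hc v

theorem hasDefectiveNumbers_of_isChoosable {C : GraphClass.{u}} {s d : ℕ}
    (hC : ∀ (V : Type u) (G : SimpleGraph V),
      minorFree (⊤ : SimpleGraph (Fin (s + 1))) V G → C V G)
    (h : ∀ (V : Type u) [Finite V] (G : SimpleGraph V), C V G → IsChoosable G s d) :
    HasDefectiveChromaticNumber C s ∧ HasDefectiveChoiceNumber C s := by
  have hlow : ∀ j d', (∀ (V : Type u) [Finite V] (G : SimpleGraph V), C V G →
      IsColourable G j d') → s ≤ j := by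
    intro j d' hj
    obtain ⟨V, hV, G, hG, hcol⟩ := exists_minorFree_le_ncard_range.{u} d' s
    obtain ⟨c, hc⟩ := hj V G (hC V G hG)
    refine (hcol _ c hc).trans ?_
    simpa using Set.ncard_le_ncard (Set.subset_univ (Set.range c))
  exact ⟨⟨⟨d, fun V _ G hG => (h V G hG).isColourable⟩, fun j ⟨d', hj⟩ => hlow j d' hj⟩,
    ⟨⟨d, h⟩, fun j ⟨d', hj⟩ => hlow j d' fun V _ G hG => (hj V G hG).isColourable⟩⟩

end LowerBound

/-! ### Recolouring and reducible vertices. -/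

section Colouring

variable {V α : Type*} [Fintype V] {G : SimpleGraph V} {s d : ℕ}

/-- The neighbours of `v` with the colour of `v`. -/
noncomputable def sameNbrs (G : SimpleGraph V) (c : V → α) (v : V) : Finset V :=
  {w | G.Adj v w ∧ c w = c v}

@[simp]
theorem mem_sameNbrs {c : V → α} {v w : V} : w ∈ sameNbrs G c v ↔ G.Adj v w ∧ c w = c v := by
  simp [sameNbrs]

theorem hasDefect_iff {c : V → α} : HasDefect G c d ↔ ∀ v, (sameNbrs G c v).card ≤ d := by
  refine forall_congr' fun v => ?_
  rw [← Nat.cast_le (α := ℕ∞), ← Set.encard_coe_eq_coe_finsetCard]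
  simp [sameNbrs]

/-- The vertices of degree at least `n`. -/
noncomputable def highVertices (G : SimpleGraph V) (n : ℕ) : Finset V :=
  {v | n ≤ (nbrs G Finset.univ v).card}

@[simp]
theorem mem_highVertices {n : ℕ} {v : V} :
    v ∈ highVertices G n ↔ n ≤ (nbrs G Finset.univ v).card := by
  simp [highVertices]

/-- Vertices of low degree can be recoloured until no defect is too large. -/
theorem exists_hasDefect_of_highVertices {L : V → Finset α} (hL : ∀ v, (L v).card = s)
    (c : V → α) (hc : ∀ v, c v ∈ L v)
    (hhigh : ∀ v ∈ highVertices G (d + s), (sameNbrs G c v).card ≤ d) :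
    ∃ c : V → α, (∀ v, c v ∈ L v) ∧ HasDefect G c d := by
  -- Each recolouring makes `v` lose all its monochromatic edges and creates none, so this sum drops
  -- and no high vertex gets worse.
  induction hn : ∑ v, (sameNbrs G c v).card using Nat.strong_induction_on generalizing c with
  | _ n ih =>
  by_cases h : ∀ v, (sameNbrs G c v).card ≤ d
  · exact ⟨c, hc, hasDefect_iff.2 h⟩
  push Not at h
  obtain ⟨v, hv⟩ := h
  have hdeg : (nbrs G Finset.univ v).card < d + s := by
    by_contra! hdeg
    exact absurd (hhigh v (mem_highVertices.2 hdeg)) (not_le.2 hv)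
  have hsub : sameNbrs G c v ⊆ nbrs G Finset.univ v := by
    intro w hw
    simp only [mem_sameNbrs, mem_nbrs] at hw ⊢
    exact ⟨Finset.mem_univ _, hw.1⟩
  have hcard := Finset.card_sdiff_add_card_eq_card hsub
  -- At least `d + 1` of fewer than `d + s` neighbours share the colour of `v`, so at most `s - 1`
  -- colours are forbidden, that of `v` included.
  obtain ⟨γ, hγ, hγ'⟩ : ∃ γ ∈ L v,
      γ ∉ insert (c v) ((nbrs G Finset.univ v \ sameNbrs G c v).image c) := by
    apply Finset.exists_mem_notMem_of_card_lt_card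
    rw [hL]
    refine (Finset.card_insert_le _ _).trans_lt ?_
    have := Finset.card_image_le (f := c) (s := nbrs G Finset.univ v \ sameNbrs G c v)
    omega
  have hγ'' : ∀ w, G.Adj v w → c w ≠ γ := by
    rintro w hw rfl
    apply hγ'
    by_cases hcw : c w = c v
    · simp [hcw]
    · refine Finset.mem_insert_of_mem (Finset.mem_image_of_mem c ?_)
      simp [hw, hcw]
  have hv0 : sameNbrs G (Function.update c v γ) v = ∅ := by
    rw [Finset.eq_empty_iff_forall_notMem]
    intro w hw
    rw [mem_sameNbrs, Function.update_self, Function.update_of_ne hw.1.ne'] at hw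
    exact hγ'' w hw.1 hw.2
  have hle : ∀ w, sameNbrs G (Function.update c v γ) w ⊆ sameNbrs G c w := by
    intro w z hz
    rcases eq_or_ne w v with rfl | hwv
    · simp [hv0] at hz
    rw [mem_sameNbrs, Function.update_of_ne hwv] at hz
    rcases eq_or_ne z v with rfl | hzv
    · rw [Function.update_self] at hz
      exact absurd hz.2.symm (hγ'' w hz.1.symm)
    · rw [Function.update_of_ne hzv] at hz
      exact mem_sameNbrs.2 hz
  refine ih _ ?_ (Function.update c v γ) (fun w => ?_)
    (fun w hw => (Finset.card_le_card (hle w)).trans (hhigh w hw)) rfl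
  · rw [← hn]
    refine Finset.sum_lt_sum (fun w _ => Finset.card_le_card (hle w)) ⟨v, Finset.mem_univ v, ?_⟩
    rw [hv0, Finset.card_empty]
    omega
  · rcases eq_or_ne w v with rfl | hwv
    · rwa [Function.update_self]
    · rw [Function.update_of_ne hwv]
      exact hc w

/-- A vertex whose edges can be deleted in an inductive construction of a colouring from lists
of size `s` with defect `d`. -/
def IsReducible (G : SimpleGraph V) (s d : ℕ) (v : V) : Prop :=
  (nbrs G (highVertices G (d + s)) v).card < s ∧
    (v ∈ highVertices G (d + s) → (nbrs G (highVertices G (d + s))ᶜ v).card <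
      (s - (nbrs G (highVertices G (d + s)) v).card) * (d + 1))

/-- Delete the edges at `v`. -/
def deleteEdgesAt (G : SimpleGraph V) (v : V) : SimpleGraph V where
  Adj x y := G.Adj x y ∧ x ≠ v ∧ y ≠ v
  symm := ⟨fun _ _ h => ⟨h.1.symm, h.2.2, h.2.1⟩⟩
  loopless := ⟨fun _ h => h.1.ne rfl⟩

/-- Recolour `v` avoiding the colours of its high neighbours, so that their defects do not grow. If
`v` is high, pigeonhole over the remaining colours also bounds its own defect. Low vertices spoilt
by this are repaired by `exists_hasDefect_of_highVertices`. -/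
theorem IsReducible.exists_hasDefect {v : V} (hv : IsReducible G s d v) {L : V → Finset α}
    (hL : ∀ v, (L v).card = s) {c : V → α} (hc : ∀ v, c v ∈ L v)
    (hdef : HasDefect (deleteEdgesAt G v) c d) :
    ∃ c : V → α, (∀ v, c v ∈ L v) ∧ HasDefect G c d := by
  set Hi := highVertices G (d + s) with hHi
  obtain ⟨hk, hlow⟩ := hv
  rw [← hHi] at hk hlow
  have hcard : s - (nbrs G Hi v).card ≤ (L v \ (nbrs G Hi v).image c).card := by
    have h1 := Finset.le_card_sdiff ((nbrs G Hi v).image c) (L v)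
    have h2 := Finset.card_image_le (f := c) (s := nbrs G Hi v)
    rw [hL] at h1
    omega
  obtain ⟨γ, hγ, hγ'⟩ : ∃ γ ∈ L v \ (nbrs G Hi v).image c,
      v ∈ Hi → ((nbrs G Hiᶜ v).filter fun w => c w = γ).card ≤ d := by
    by_cases hvHi : v ∈ Hi
    · obtain ⟨γ, hγ, h⟩ := Finset.exists_card_fiber_lt_of_card_lt_mul (f := c)
        ((hlow hvHi).trans_le (Nat.mul_le_mul_right _ hcard))
      exact ⟨γ, hγ, fun _ => Nat.lt_succ_iff.1 h⟩
    · obtain ⟨γ, hγ⟩ := Finset.card_pos.1 (hcard.trans_lt' (Nat.sub_pos_of_lt hk))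
      exact ⟨γ, hγ, fun h => absurd h hvHi⟩
  rw [Finset.mem_sdiff] at hγ
  have hγ'' : ∀ w ∈ Hi, G.Adj v w → c w ≠ γ := by
    rintro w hw hvw rfl
    exact hγ.2 (Finset.mem_image_of_mem c (mem_nbrs.2 ⟨hw, hvw⟩))
  rw [hasDefect_iff] at hdef
  refine exists_hasDefect_of_highVertices hL (Function.update c v γ) (fun w => ?_) fun w hw => ?_
  · rcases eq_or_ne w v with rfl | hwv
    · rw [Function.update_self]
      exact hγ.1
    · rw [Function.update_of_ne hwv]
      exact hc w
  · rw [← hHi] at hw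
    rcases eq_or_ne w v with rfl | hwv
    · refine (Finset.card_le_card fun z hz => ?_).trans (hγ' hw)
      rw [mem_sameNbrs, Function.update_self, Function.update_of_ne hz.1.ne'] at hz
      rw [Finset.mem_filter, mem_nbrs, Finset.mem_compl]
      exact ⟨⟨fun hzHi => hγ'' z hzHi hz.1 hz.2, hz.1⟩, hz.2⟩
    · refine (Finset.card_le_card fun z hz => ?_).trans (hdef w)
      rw [mem_sameNbrs, Function.update_of_ne hwv] at hz
      rcases eq_or_ne z v with rfl | hzv
      · rw [Function.update_self] at hz
        exact absurd hz.2.symm (hγ'' w hw hz.1.symm)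
      · rw [Function.update_of_ne hzv] at hz
        exact mem_sameNbrs.2 ⟨⟨hz.1, hwv, hzv⟩, hz.2⟩

/-- Deleting the edges at `v` rather than `v` itself keeps the vertex set and lists fixed; the
induction is on the subgraph order, and the edge `vw` makes the step strict. -/
theorem isChoosable_of_exists_isReducible {V : Type u} [Fintype V] {P : SimpleGraph V → Prop}
    {s d : ℕ} (hs : 0 < s) (hP : ∀ G G', G ≤ G' → P G' → P G)
    (h : ∀ G, P G → G ≠ ⊥ → ∃ v w, G.Adj v w ∧ IsReducible G s d v) (G : SimpleGraph V) (hG : P G) :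
    IsChoosable G s d := by
  intro α L hL
  revert hG
  refine wellFounded_lt.induction (C := fun G => P G → ∃ c : V → α, (∀ v, c v ∈ L v) ∧
    HasDefect G c d) G fun G ih hG => ?_
  by_cases hbot : G = ⊥
  · have hne : ∀ v, ∃ γ, γ ∈ L v := fun v => Finset.card_pos.1 (hs.trans_eq (hL v).symm)
    choose c hc using hne
    refine ⟨c, hc, fun v => ?_⟩
    simp [hbot]
  · obtain ⟨v, w, hvw, hv⟩ := h G hG hbot
    have hlt : deleteEdgesAt G v < G := by
      refine lt_of_le_of_ne (fun x y hxy => hxy.1) fun heq => ?_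
      rw [← heq] at hvw
      exact hvw.2.1 rfl
    obtain ⟨c, hc, hdef⟩ := ih _ hlt (hP _ _ hlt.le hG)
    exact hv.exists_hasDefect hL hc hdef

end Colouring

/-! ### Edge counts in a graph without reducible vertices, and the case `s ≥ 4`. -/

theorem isTopologicalMinor_top_of_clique {V : Type*} {G : SimpleGraph V} {n : ℕ} (Z : Finset V)
    (hZ : Z.card = n) (h : ∀ x ∈ Z, ∀ y ∈ Z, x ≠ y → G.Adj x y) :
    IsTopologicalMinor (⊤ : SimpleGraph (Fin n)) G := by
  let f := (Z.equivFinOfCardEq hZ).symm.toEmbedding.trans (.subtype _)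
  have hf : ∀ c, f c ∈ Z := fun c => ((Z.equivFinOfCardEq hZ).symm c).2
  refine isTopologicalMinor_of_forall_walkIn f (fun _ => ∅) (by simp) (by simp)
    fun a b hab => .adj (h _ (hf a) _ (hf b) fun he => hab (f.injective he)) ?_ ?_
  · simp
  · simp

theorem adjPairs_eq_card_filter {V : Type*} (G : SimpleGraph V) (S T : Finset V) :
    adjPairs G S T = ((S ×ˢ T).filter fun p => G.Adj p.1 p.2).card := by
  simp only [adjPairs, nbrs, Finset.card_filter, Finset.sum_product]

theorem adjPairs_add_two_le_suppress {V : Type*} {G : SimpleGraph V} {a u v : V} {S : Finset V}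
    (ha : a ∉ S) (hu : u ∈ S) (hv : v ∈ S) (huv : u ≠ v) (h : ¬ G.Adj u v) :
    adjPairs G S S + 2 ≤ adjPairs (suppress G a u v) S S := by
  rw [adjPairs_eq_card_filter, adjPairs_eq_card_filter]
  have h1 : ({(u, v), (v, u)} : Finset (V × V)).card = 2 := by
    rw [Finset.card_pair]
    simp [huv]
  rw [← h1, ← Finset.card_union_of_disjoint]
  · refine Finset.card_le_card ?_
    rintro ⟨x, y⟩ hxy
    simp only [Finset.mem_union, Finset.mem_filter, Finset.mem_product, Finset.mem_insert,
      Finset.mem_singleton, Prod.mk.injEq] at hxy ⊢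
    rcases hxy with ⟨⟨hx, hy⟩, hxy⟩ | ⟨rfl, rfl⟩ | ⟨rfl, rfl⟩
    · exact ⟨⟨hx, hy⟩, hxy.ne, .inl ⟨hxy, fun h => ha (h ▸ hx), fun h => ha (h ▸ hy)⟩⟩
    · exact ⟨⟨hu, hv⟩, huv, .inr rfl⟩
    · exact ⟨⟨hv, hu⟩, huv.symm, .inr Sym2.eq_swap⟩
  · rw [Finset.disjoint_right]
    rintro ⟨x, y⟩ hxy
    simp only [Finset.mem_insert, Finset.mem_singleton, Prod.mk.injEq] at hxy
    simp only [Finset.mem_filter, not_and]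
    rcases hxy with ⟨rfl, rfl⟩ | ⟨rfl, rfl⟩
    · exact fun _ => h
    · exact fun _ h' => h h'.symm

section Suppression

variable {s : ℕ} {C : GraphClass.{u}}

/-- Suppressing one by one the vertices of `A`, each of which has `s` neighbours in `B`, bounds
the number of these vertices. -/
theorem IsSuppressClosed.adjPairs_add_le (hC : IsSuppressClosed s C) {δ : ℝ}
    (hδ : δ ∈ upperBounds (densities C)) {V : Type u} (B A : Finset V) (hAB : Disjoint A B) :
    ∀ G : SimpleGraph V, C V G → (∀ a ∈ A, s ≤ (nbrs G B a).card) →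
      (adjPairs G B B : ℝ) + 2 * A.card ≤ 2 * (δ * B.card) := by
  induction A using Finset.induction with
  | empty =>
    intro G hG _
    simpa using hC.adjPairs_le hδ hG B
  | insert a A haA ih =>
    intro G hG hA
    rw [Finset.disjoint_insert_left] at hAB
    obtain ⟨T, hT, hTs⟩ := Finset.exists_subset_card_eq (hA a (Finset.mem_insert_self a A))
    have hTB : ∀ x ∈ T, x ∈ B ∧ G.Adj a x := fun x hx => mem_nbrs.1 (hT hx)
    have haT : a ∉ T := fun h => hAB.1 (hTB a h).1
    -- If the `s` chosen neighbours were pairwise adjacent, they would form a `K_{s+1}` with `a`.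
    obtain ⟨u, hu, v, hv, huv, hadj⟩ : ∃ u ∈ T, ∃ v ∈ T, u ≠ v ∧ ¬ G.Adj u v := by
      by_contra! hcl
      refine hC.not_isTopologicalMinor hG (isTopologicalMinor_top_of_clique (insert a T)
        (by rw [Finset.card_insert_of_notMem haT, hTs]) fun x hx y hy hxy => ?_)
      rcases Finset.mem_insert.1 hx with rfl | hx <;> rcases Finset.mem_insert.1 hy with rfl | hy
      · exact absurd rfl hxy
      · exact (hTB _ hy).2
      · exact (hTB _ ‹_›).2.symm
      · exact hcl x ‹_› y ‹_› hxy
    have h1 := ih hAB.2 (DefectiveColouring.suppress G a u v)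
      (hC.suppress huv (hTB u hu).2 (hTB v hv).2 hG) fun b hb => by
        refine (hA b (Finset.mem_insert_of_mem hb)).trans (Finset.card_le_card fun x hx => ?_)
        rw [mem_nbrs] at hx ⊢
        exact ⟨hx.1, hx.2.ne, .inl ⟨hx.2, fun h => haA (h ▸ hb), fun h => hAB.1 (h ▸ hx.1)⟩⟩
    have h2 : (adjPairs G B B : ℝ) + 2 ≤
        adjPairs (DefectiveColouring.suppress G a u v) B B := by
      exact_mod_cast adjPairs_add_two_le_suppress hAB.1 (hTB u hu).1 (hTB v hv).1 huv hadj
    rw [Finset.card_insert_of_notMem haA]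
    push_cast
    linarith

/-- Here `a = |A|`, `b = |B|`, `x = e(A,B)` and `m = e(B)`. Eliminating `a` and `x` bounds `q = sb -
2m`, the total shortfall of the degrees inside `B` from `s`, below by `h7` and above by `h9`.
Together they give `p(p+1) < δ(δ-1)`, against `p ≥ δ - 1`. -/
theorem density_inequalities_contradiction {s δ D a b x m : ℝ} (hs : 4 ≤ s) (hδ : s - 1 ≤ δ)
    (hD : δ * (2 * δ - s + 1) < D + s) (hb : 0 < b)
    (h1 : (D + s) * b ≤ x + 2 * m) (h2 : s * (D + 1) * b ≤ x + 2 * m * (D + 1))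
    (h3 : x + m ≤ δ * (a + b)) (h4 : a + m ≤ δ * b) : False := by
  have hδ3 : 3 ≤ δ := by linarith
  have h5 : x ≤ δ * (δ + 1) * b - (δ + 1) * m := by
    nlinarith [mul_le_mul_of_nonneg_left h4 (by linarith : 0 ≤ δ)]
  have h6 : (δ - 1) * m < δ * (s - δ) * b := by
    nlinarith [mul_lt_mul_of_pos_right hD hb]
  set p := 2 * δ ^ 2 - s * (δ + 1) with hp
  set q := s * b - 2 * m with hq
  -- Since `s ≤ δ + 1`, the difference is at least `δ(δ - 3)`; this is where `s ≥ 4` enters.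
  have hp0 : δ - 1 ≤ p := by
    nlinarith [mul_le_mul_of_nonneg_right hδ (by linarith : 0 ≤ δ + 1),
      mul_nonneg (by linarith : 0 ≤ δ) (by linarith : 0 ≤ δ - 3)]
  have h7 : p * b < (δ - 1) * q := by
    rw [hp, hq]
    nlinarith
  have hq0 : 0 < q := by
    have : 0 < p * b := mul_pos (by linarith) hb
    by_contra! hq'
    nlinarith
  have h8 : (p + δ + 1) * q < (D + 1) * q := by
    apply mul_lt_mul_of_pos_right _ hq0
    rw [hp]
    nlinarith
  have h9 : (2 * p + δ + 1) * q < (p + 2 * δ) * b := by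
    have h10 : (D + 1) * q ≤ (δ + 1) * (δ * b - m) := by
      rw [hq]
      nlinarith
    have h11 : 2 * ((δ + 1) * (δ * b - m)) = (p + 2 * δ) * b + (δ + 1) * q := by
      rw [hp, hq]
      ring
    nlinarith
  have h10 : (2 * p + δ + 1) * (p * b) < (δ - 1) * ((p + 2 * δ) * b) := by
    have h11 : (2 * p + δ + 1) * (p * b) < (2 * p + δ + 1) * ((δ - 1) * q) :=
      mul_lt_mul_of_pos_left h7 (by linarith)
    have h12 : (δ - 1) * ((2 * p + δ + 1) * q) < (δ - 1) * ((p + 2 * δ) * b) :=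
      mul_lt_mul_of_pos_left h9 (by linarith)
    linarith
  have h13 : (p * (p + 1)) * b < (δ * (δ - 1)) * b := by linarith
  have h14 := lt_of_mul_lt_mul_right h13 hb.le
  nlinarith

section Irreducible

variable {V : Type*} [Fintype V] {G : SimpleGraph V} {d : ℕ}

/-- The non-isolated vertices of degree less than `n`. -/
noncomputable def lowVertices (G : SimpleGraph V) (n : ℕ) : Finset V :=
  {v | v ∉ highVertices G n ∧ ∃ w, G.Adj v w}

theorem mem_lowVertices {n : ℕ} {v : V} :
    v ∈ lowVertices G n ↔ v ∉ highVertices G n ∧ ∃ w, G.Adj v w := by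
  simp [lowVertices]

theorem disjoint_lowVertices_highVertices (G : SimpleGraph V) (n : ℕ) :
    Disjoint (lowVertices G n) (highVertices G n) :=
  Finset.disjoint_left.2 fun _ h => (mem_lowVertices.1 h).1

theorem nbrs_lowVertices (G : SimpleGraph V) (n : ℕ) (v : V) :
    nbrs G (lowVertices G n) v = nbrs G (highVertices G n)ᶜ v := by
  ext w
  simp only [mem_nbrs, mem_lowVertices, Finset.mem_compl]
  exact ⟨fun h => ⟨h.1.1, h.2⟩, fun h => ⟨⟨h.1, v, h.2.symm⟩, h.2⟩⟩

theorem card_nbrs_univ (G : SimpleGraph V) (n : ℕ) (v : V) :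
    (nbrs G Finset.univ v).card =
      (nbrs G (highVertices G n) v).card + (nbrs G (lowVertices G n) v).card := by
  rw [nbrs_lowVertices, ← card_nbrs_union disjoint_compl_right, Finset.union_compl]

theorem le_card_nbrs_of_mem_lowVertices
    (hirr : ∀ v w, G.Adj v w → ¬ IsReducible G s d v) {v : V}
    (hv : v ∈ lowVertices G (d + s)) :
    s ≤ (nbrs G (highVertices G (d + s)) v).card := by
  obtain ⟨hv, w, hvw⟩ := mem_lowVertices.1 hv
  by_contra! h
  exact hirr v w hvw ⟨h, fun h' => absurd h' hv⟩

theorem highVertices_nonempty (hirr : ∀ v w, G.Adj v w → ¬ IsReducible G s d v)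
    (hs : 0 < s) (hG : G ≠ ⊥) : (highVertices G (d + s)).Nonempty := by
  obtain ⟨v, w, hvw⟩ := SimpleGraph.ne_bot_iff_exists_adj.1 hG
  by_cases hv : v ∈ highVertices G (d + s)
  · exact ⟨v, hv⟩
  · have h := le_card_nbrs_of_mem_lowVertices hirr (mem_lowVertices.2 ⟨hv, w, hvw⟩)
    obtain ⟨u, hu⟩ := Finset.card_pos.1 (hs.trans_le h)
    exact ⟨u, (mem_nbrs.1 hu).1⟩

/-- If `v` has fewer than `s` high neighbours, this is the failure of the second condition of
`IsReducible`; otherwise the last term alone suffices. -/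
theorem mul_le_of_mem_highVertices (hirr : ∀ v w, G.Adj v w → ¬ IsReducible G s d v)
    (hs : 0 < s) {v : V} (hv : v ∈ highVertices G (d + s)) :
    s * (d + 1) ≤ (nbrs G (lowVertices G (d + s)) v).card +
      (nbrs G (highVertices G (d + s)) v).card * (d + 1) := by
  obtain ⟨w, hw⟩ := Finset.card_pos.1 ((Nat.add_pos_right d hs).trans_le (mem_highVertices.1 hv))
  have h := hirr v w (mem_nbrs.1 hw).2
  rw [IsReducible, ← nbrs_lowVertices] at h
  by_cases hk : (nbrs G (highVertices G (d + s)) v).card < s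
  · have h1 : (s - (nbrs G (highVertices G (d + s)) v).card) * (d + 1) ≤
        (nbrs G (lowVertices G (d + s)) v).card := by
      by_contra! h'
      exact h ⟨hk, fun _ => h'⟩
    rw [Nat.sub_mul] at h1
    omega
  · exact (Nat.mul_le_mul_right _ (not_lt.1 hk)).trans (Nat.le_add_left _ _)

end Irreducible

theorem IsSuppressClosed.exists_isReducible_of_four_le (hC : IsSuppressClosed s C) (hs : 4 ≤ s)
    {δ : ℝ} (hδ : δ ∈ upperBounds (densities C)) (hsδ : (s : ℝ) - 1 ≤ δ) {d : ℕ}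
    (hd : δ * (2 * δ - s + 1) < d + s) {V : Type u} [Fintype V] {G : SimpleGraph V} (hG : C V G)
    (hbot : G ≠ ⊥) : ∃ v w, G.Adj v w ∧ IsReducible G s d v := by
  by_contra! hirr
  have hs0 : 0 < s := by omega
  set A := lowVertices G (d + s) with hA
  set B := highVertices G (d + s) with hB
  have hAB : Disjoint A B := disjoint_lowVertices_highVertices G _
  have h1 : (d + s) * B.card ≤ adjPairs G B A + adjPairs G B B := by
    rw [adjPairs, adjPairs, ← Finset.sum_add_distrib, mul_comm, ← smul_eq_mul]
    refine Finset.card_nsmul_le_sum _ _ _ fun v hv => ?_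
    rw [add_comm (nbrs G A v).card, ← card_nbrs_univ]
    exact mem_highVertices.1 hv
  have h2 : s * (d + 1) * B.card ≤ adjPairs G B A + adjPairs G B B * (d + 1) := by
    rw [adjPairs, adjPairs, Finset.sum_mul, ← Finset.sum_add_distrib, mul_comm, ← smul_eq_mul]
    exact Finset.card_nsmul_le_sum _ _ _ fun v hv => mul_le_of_mem_highVertices hirr hs0 hv
  have h3 := hC.adjPairs_le hδ hG (A ∪ B)
  have h4 := hC.adjPairs_add_le hδ B A hAB G hG fun a ha =>
    le_card_nbrs_of_mem_lowVertices hirr ha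
  rw [adjPairs_union_self hAB, Finset.card_union_of_disjoint hAB, adjPairs_comm A B] at h3
  push_cast at h3
  have hA0 : (0 : ℝ) ≤ adjPairs G A A := Nat.cast_nonneg _
  -- Halving `adjPairs G B B` gives the number of edges inside `B`.
  refine density_inequalities_contradiction (s := s) (δ := δ) (D := d) (a := A.card)
    (b := B.card) (x := adjPairs G B A) (m := adjPairs G B B / 2) (by exact_mod_cast hs) hsδ hd
    (by exact_mod_cast (highVertices_nonempty hirr hs0 hbot).card_pos)
    ?_ ?_ (by linarith) (by linarith)
  · rw [mul_div_cancel₀ _ two_ne_zero]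
    exact_mod_cast h1
  · rw [mul_div_cancel₀ _ two_ne_zero]
    exact_mod_cast h2

end Suppression

/-! ### Longest paths: minimum degree 2 or 3 forces a subdivided `K₃` or `K₄`. -/

section MinDegree

variable {V : Type*} {G : SimpleGraph V} {p : ℕ → V} {k : ℕ}

/-- The vertices `p 0, …, p k` form a path of `G` in this order. -/
def IsPathMap (G : SimpleGraph V) (p : ℕ → V) (k : ℕ) : Prop :=
  Set.InjOn p (Set.Iic k) ∧ ∀ i < k, G.Adj (p i) (p (i + 1))

theorem IsPathMap.walkIn_Icc (hp : IsPathMap G p k) {i j : ℕ} (hij : i ≤ j) (hj : j ≤ k) :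
    WalkIn G (p '' Set.Icc i j) (p i) (p j) := by
  induction j, hij using Nat.le_induction with
  | base => exact .refl ⟨i, by simp, rfl⟩
  | succ j hij ih =>
    refine ((ih (by omega)).mono (Set.image_mono (Set.Icc_subset_Icc_right (by omega)))).trans
      (.adj (hp.2 j (by omega)) ⟨j, ⟨hij, by omega⟩, rfl⟩ ⟨j + 1, ⟨by omega, le_rfl⟩, rfl⟩)

theorem IsPathMap.cons (hp : IsPathMap G p k) {w : V} (hw : G.Adj w (p 0))
    (hwp : ∀ j ≤ k, p j ≠ w) :
    IsPathMap G (fun n => if n = 0 then w else p (n - 1)) (k + 1) := by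
  refine ⟨fun m hm n hn hmn => ?_, fun i hi => ?_⟩
  · rw [Set.mem_Iic] at hm hn
    dsimp only at hmn
    split_ifs at hmn with h1 h2 h2
    · omega
    · exact absurd hmn.symm (hwp _ (by omega))
    · exact absurd hmn (hwp _ (by omega))
    · have := hp.1 (Set.mem_Iic.2 (by omega)) (Set.mem_Iic.2 (by omega)) hmn
      omega
  · rcases Nat.eq_zero_or_pos i with rfl | h0
    · simpa using hw
    · have h1 := hp.2 (i - 1) (by omega)
      rw [Nat.sub_add_cancel h0] at h1
      simpa [h0.ne'] using h1

/-- If `p 0` is adjacent to `p i`, reversing the first part of the path gives a path that starts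
at `p (i - 1)`. -/
theorem IsPathMap.rotate (hp : IsPathMap G p k) {i : ℕ}
    (hik : i ≤ k) (hadj : G.Adj (p 0) (p i)) :
    IsPathMap G (fun n => if n < i then p (i - 1 - n) else p n) k := by
  refine ⟨fun m hm n hn hmn => ?_, fun n hn => ?_⟩
  · rw [Set.mem_Iic] at hm hn
    dsimp only at hmn
    split_ifs at hmn with h1 h2 h2 <;>
    · have := hp.1 (Set.mem_Iic.2 (by omega)) (Set.mem_Iic.2 (by omega)) hmn
      omega
  · dsimp only
    rcases lt_trichotomy (n + 1) i with h | h | h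
    · rw [if_pos (by omega), if_pos h]
      have := hp.2 (i - 1 - (n + 1)) (by omega)
      rw [show i - 1 - (n + 1) + 1 = i - 1 - n by omega] at this
      exact this.symm
    · rw [if_pos (by omega), if_neg (by omega), show i - 1 - n = 0 by omega, h]
      exact hadj
    · rw [if_neg (by omega), if_neg (by omega)]
      exact hp.2 n hn

theorem IsPathMap.lt_card [Fintype V] (hp : IsPathMap G p k) : k < Fintype.card V := by
  have h := Finset.card_le_card_of_injOn p (s := Finset.range (k + 1)) (t := Finset.univ)
    (fun _ _ => Finset.mem_coe.2 (Finset.mem_univ _)) fun m hm n hn =>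
      hp.1 (by simpa [Nat.lt_succ_iff] using hm) (by simpa [Nat.lt_succ_iff] using hn)
  rwa [Finset.card_range, Finset.card_univ] at h

theorem exists_longest_isPathMap [Fintype V] (hG : G ≠ ⊥) :
    ∃ k, 1 ≤ k ∧ (∃ p, IsPathMap G p k) ∧ ∀ p, ¬ IsPathMap G p (k + 1) := by
  obtain ⟨v, w, hvw⟩ := SimpleGraph.ne_bot_iff_exists_adj.1 hG
  have h0 : IsPathMap G (fun _ => w) 0 := by
    refine ⟨fun m hm n hn _ => ?_, fun i hi => absurd hi (Nat.not_lt_zero i)⟩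
    rw [Set.mem_Iic] at hm hn
    omega
  have h1 := h0.cons hvw fun _ _ h => hvw.ne h.symm
  let P : ℕ → Prop := fun k => ∃ p, IsPathMap G p k
  have hbd : 1 ≤ Fintype.card V := Fintype.card_pos_iff.2 ⟨v⟩
  have hP1 : P 1 := ⟨_, h1⟩
  refine ⟨Nat.findGreatest P (Fintype.card V), Nat.le_findGreatest hbd hP1,
    Nat.findGreatest_spec hbd hP1, fun p hp => ?_⟩
  have := Nat.le_findGreatest hp.lt_card.le (P := P) ⟨p, hp⟩
  omega

/-- The neighbours of the first vertex of a longest path are on the path. -/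
theorem IsPathMap.exists_adj_of_longest [Fintype V] {s : ℕ}
    (hdeg : ∀ v w, G.Adj v w → s ≤ (nbrs G Finset.univ v).card)
    (hk : 1 ≤ k) (hmax : ∀ p, ¬ IsPathMap G p (k + 1)) (hp : IsPathMap G p k) (J : Finset ℕ)
    (hJ : J.card < s) : ∃ j ≤ k, j ≠ 0 ∧ j ∉ J ∧ G.Adj (p 0) (p j) := by
  obtain ⟨w, hw, hwJ⟩ := Finset.exists_mem_notMem_of_card_lt_card
    ((Finset.card_image_le (f := p) (s := J)).trans_lt
      (hJ.trans_le (hdeg (p 0) (p 1) (hp.2 0 hk))))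
  rw [mem_nbrs] at hw
  obtain ⟨j, hj, rfl⟩ : ∃ j ≤ k, p j = w := by
    by_contra! h
    exact hmax _ (hp.cons hw.2.symm h)
  refine ⟨j, hj, ?_, fun h => hwJ (Finset.mem_image_of_mem p h), hw.2⟩
  rintro rfl
  exact hw.2.ne rfl

/-- Branch vertices and path interiors are given by positions on one path, so disjointness reduces
to arithmetic of indices. -/
theorem isTopologicalMinor_top_of_path {n : ℕ} (hp : Set.InjOn p (Set.Iic k)) (g : Fin n → ℕ)
    (hg : Function.Injective g) (hgk : ∀ c, g c ≤ k) (I : Sym2 (Fin n) → Set ℕ)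
    (hI : ∀ e, ∀ m ∈ I e, m ≤ k ∧ (∀ c, g c ≠ m) ∧ ∀ e', m ∈ I e' → e = e')
    (hw : ∀ a b, a < b → ∃ J, (∀ m ∈ J, m ∈ I s(a, b) ∨ m = g a ∨ m = g b) ∧
      WalkIn G (p '' J) (p (g a)) (p (g b))) :
    IsTopologicalMinor (⊤ : SimpleGraph (Fin n)) G := by
  let f : Fin n ↪ V := ⟨fun c => p (g c), fun c d h => hg (hp (hgk c) (hgk d) h)⟩
  have key : ∀ a b, a < b → WalkIn G (p '' I s(a, b) ∪ {f a, f b}) (f a) (f b) := by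
    intro a b hab
    obtain ⟨J, hJ, h⟩ := hw a b hab
    refine h.mono ?_
    rintro _ ⟨m, hm, rfl⟩
    rcases hJ m hm with h | rfl | rfl
    · exact .inl ⟨m, h, rfl⟩
    · exact .inr (.inl rfl)
    · exact .inr (.inr rfl)
  refine isTopologicalMinor_of_forall_walkIn f (fun e => p '' I e) ?_ (fun e e' hne => ?_)
    fun a b hab => ?_
  · rintro e c ⟨m, hm, hmc⟩
    exact (hI e m hm).2.1 c (hp (hgk c) (hI e m hm).1 hmc.symm)
  · rw [Set.disjoint_left]
    rintro _ ⟨m, hm, rfl⟩ ⟨m', hm', h⟩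
    obtain rfl := hp (hI e' m' hm').1 (hI e m hm).1 h
    exact hne ((hI e m' hm).2.2 e' hm')
  · rcases hab.lt_or_gt with h | h
    · exact key a b h
    · rw [Sym2.eq_swap, Set.pair_comm]
      exact (key b a h).symm

theorem IsPathMap.walkIn_pair (p : ℕ → V) {i j : ℕ} (h : G.Adj (p i) (p j)) :
    WalkIn G (p '' {i, j}) (p i) (p j) :=
  .adj h (Set.mem_image_of_mem p (by simp)) (Set.mem_image_of_mem p (by simp))

theorem IsPathMap.walkIn_insert_Icc (hp : IsPathMap G p k) {i c u : ℕ} (hcu : c ≤ u) (hu : u ≤ k)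
    (h : G.Adj (p i) (p u)) : WalkIn G (p '' insert i (Set.Icc c u)) (p i) (p c) :=
  (WalkIn.adj h (Set.mem_image_of_mem p (by simp)) (Set.mem_image_of_mem p (by simp [hcu]))).trans
    ((hp.walkIn_Icc hcu hu).symm.mono (Set.image_mono (Set.subset_insert _ _)))

/-- The first vertex of a longest path has a second neighbour on the path, which closes a cycle. -/
theorem isTopologicalMinor_three_of_degree [Fintype V] (hG : G ≠ ⊥)
    (hdeg : ∀ v w, G.Adj v w → 2 ≤ (nbrs G Finset.univ v).card) :
    IsTopologicalMinor (⊤ : SimpleGraph (Fin 3)) G := by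
  obtain ⟨k, hk, ⟨p, hp⟩, hmax⟩ := exists_longest_isPathMap hG
  obtain ⟨i, hik, hi0, hi1, hadj⟩ := hp.exists_adj_of_longest hdeg hk hmax {1} (by simp)
  rw [Finset.mem_singleton] at hi1
  refine isTopologicalMinor_top_of_path hp.1 ![0, 1, i] ?_ ?_
    (fun e => {m | e = s(1, 2) ∧ 1 < m ∧ m < i}) ?_ ?_
  · intro a b
    fin_cases a <;> fin_cases b <;> simp <;> omega
  · intro a
    fin_cases a <;> simp <;> omega
  · rintro e m ⟨rfl, h1, h2⟩
    refine ⟨by omega, fun c => ?_, fun e' he' => he'.1.symm⟩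
    fin_cases c <;> simp <;> omega
  · intro a b hab
    have h01 := IsPathMap.walkIn_pair p (hp.2 0 (by omega))
    have h02 := IsPathMap.walkIn_pair p hadj
    have h12 := hp.walkIn_Icc (i := 1) (j := i) (by omega) hik
    fin_cases a <;> fin_cases b <;> first
      | exact absurd hab (by decide)
      | exact ⟨_, fun m hm => .inr hm, h01⟩
      | exact ⟨_, fun m hm => .inr hm, h02⟩
      | refine ⟨_, fun m hm => ?_, h12⟩
        rw [Set.mem_Icc] at hm
        simp
        omega

/-- Dirac: a graph all of whose non-isolated vertices have degree at least 3 contains a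
subdivision of `K₄`. -/
theorem isTopologicalMinor_four_of_degree [Fintype V] (hG : G ≠ ⊥)
    (hdeg : ∀ v w, G.Adj v w → 3 ≤ (nbrs G Finset.univ v).card) :
    IsTopologicalMinor (⊤ : SimpleGraph (Fin 4)) G := by
  obtain ⟨k, hk, hex, hmax⟩ := exists_longest_isPathMap hG
  -- Take `i ≥ 2` least such that some longest path has its first vertex adjacent to its vertex at
  -- position `i`. By minimality, the third neighbour of the first vertex of any longest path lies
  -- beyond `i`.
  let Q : ℕ → Prop := fun i => 2 ≤ i ∧ i ≤ k ∧ ∃ p, IsPathMap G p k ∧ G.Adj (p 0) (p i)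
  have hQ : ∃ i, Q i := by
    obtain ⟨p, hp⟩ := hex
    obtain ⟨i, hik, hi0, hi1, hadj⟩ := hp.exists_adj_of_longest hdeg hk hmax {1} (by simp)
    rw [Finset.mem_singleton] at hi1
    exact ⟨i, by omega, hik, p, hp, hadj⟩
  obtain ⟨hi2, hik, p, hp, hadj⟩ := Nat.find_spec hQ
  have hnext : ∀ q, IsPathMap G q k →
      ∃ t, Nat.find hQ < t ∧ t ≤ k ∧ G.Adj (q 0) (q t) := by
    intro q hq
    obtain ⟨t, htk, ht0, htJ, htadj⟩ := hq.exists_adj_of_longest hdeg hk hmax {1, Nat.find hQ}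
      (Finset.card_le_two.trans_lt (by omega))
    simp only [Finset.mem_insert, Finset.mem_singleton, not_or] at htJ
    have := Nat.find_min' hQ (m := t) ⟨by omega, htk, q, hq, htadj⟩
    exact ⟨t, by omega, htk, htadj⟩
  obtain ⟨u, hiu, huk, hu⟩ := hnext p hp
  -- The rotated path starts at `p (i - 1)` and agrees with `p` from position `i` on, so `p (i - 1)`
  -- also has a neighbour beyond `i`.
  obtain ⟨t, hit, htk, ht⟩ := hnext _ (hp.rotate hik hadj)
  generalize Nat.find hQ = i at *
  simp only [show 0 < i by omega, if_true, not_lt.2 hit.le, if_false, Nat.sub_zero] at ht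
  -- The fourth branch vertex is at `c = min u t`. The paths from `p 0` and `p (i - 1)` jump to `u`
  -- and `t` and descend to `c`; one of the descents is trivial, so they do not collide.
  obtain ⟨c, hcu, hct, hc⟩ : ∃ c ≤ u, c ≤ t ∧ (c = u ∨ c = t) := by
    rcases le_total u t with h | h
    · exact ⟨u, le_rfl, h, .inl rfl⟩
    · exact ⟨t, h, le_rfl, .inr rfl⟩
  have hic : i < c := by omega
  refine isTopologicalMinor_top_of_path hp.1 ![0, i - 1, i, c] ?_ ?_
    (fun e => {m | e = s(0, 1) ∧ 0 < m ∧ m < i - 1 ∨ e = s(2, 3) ∧ i < m ∧ m < c ∨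
      e = s(0, 3) ∧ c < m ∧ m ≤ u ∨ e = s(1, 3) ∧ c < m ∧ m ≤ t}) ?_ ?_
  · intro a b
    fin_cases a <;> fin_cases b <;> simp <;> omega
  · intro a
    fin_cases a <;> simp <;> omega
  · intro e m hm
    refine ⟨?_, fun d => ?_, fun e' hm' => ?_⟩
    · rcases hm with h | h | h | h <;> omega
    · fin_cases d <;> rcases hm with h | h | h | h <;> simp <;> omega
    · rcases hm with h | h | h | h <;> rcases hm' with h' | h' | h' | h' <;>
        first
        | exact h.1.trans h'.1.symm
        | omega
  · intro a b hab
    have h01 := hp.walkIn_Icc (i := 0) (j := i - 1) (by omega) (by omega)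
    have h02 := IsPathMap.walkIn_pair p hadj
    have h03 := hp.walkIn_insert_Icc hcu huk hu
    have h12 := hp.walkIn_Icc (i := i - 1) (j := i) (by omega) hik
    have h13 := hp.walkIn_insert_Icc hct htk ht
    have h23 := hp.walkIn_Icc (i := i) (j := c) (by omega) (by omega)
    fin_cases a <;> fin_cases b <;> first
      | exact absurd hab (by decide)
      | exact ⟨_, fun m hm => .inr hm, h02⟩
      | refine ⟨_, fun m hm => ?_, h01⟩
        rw [Set.mem_Icc] at hm
        simp
        omega
      | refine ⟨_, fun m hm => ?_, h12⟩
        rw [Set.mem_Icc] at hm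
        simp
        omega
      | refine ⟨_, fun m hm => ?_, h23⟩
        rw [Set.mem_Icc] at hm
        simp
        omega
      | refine ⟨_, fun m hm => ?_, h03⟩
        rw [Set.mem_insert_iff, Set.mem_Icc] at hm
        simp
        omega
      | refine ⟨_, fun m hm => ?_, h13⟩
        rw [Set.mem_insert_iff, Set.mem_Icc] at hm
        simp
        omega

end MinDegree

/-! ### The case `s ≤ 3` and the conclusion for both classes. -/

section Choosability

variable {s : ℕ} {C : GraphClass.{u}}

theorem IsSuppressClosed.exists_isReducible_of_le_three (hC : IsSuppressClosed s C) (hs2 : 2 ≤ s)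
    (hs3 : s ≤ 3) {d : ℕ} {V : Type u} [Fintype V] {G : SimpleGraph V} (hG : C V G)
    (hbot : G ≠ ⊥) : ∃ v w, G.Adj v w ∧ IsReducible G s d v := by
  by_contra! hirr
  have hdeg : ∀ v w, G.Adj v w → s ≤ (nbrs G Finset.univ v).card := by
    intro v w hvw
    by_cases hv : v ∈ highVertices G (d + s)
    · exact (Nat.le_add_left s d).trans (mem_highVertices.1 hv)
    · refine (le_card_nbrs_of_mem_lowVertices hirr (mem_lowVertices.2 ⟨hv, w, hvw⟩)).trans ?_
      exact Finset.card_le_card (Finset.filter_subset_filter _ (Finset.subset_univ _))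
  apply hC.not_isTopologicalMinor hG
  obtain rfl | rfl : s = 2 ∨ s = 3 := by omega
  · exact isTopologicalMinor_three_of_degree hbot hdeg
  · exact isTopologicalMinor_four_of_degree hbot hdeg

theorem minorFree_bot_punit (hs : 1 ≤ s) :
    minorFree (⊤ : SimpleGraph (Fin (s + 1))) PUnit.{u + 1} ⊥ := by
  rintro ⟨B, -, -, ha⟩
  obtain ⟨x, -, y, -, h⟩ := ha 0 (Fin.last s) (by simp [Fin.ext_iff]; omega)
  exact h

theorem IsSuppressClosed.hasDefectiveNumbers_and_isChoosable (hs : 2 ≤ s)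
    (hC : IsSuppressClosed s C) (hmf : ∀ (V : Type u) (G : SimpleGraph V),
      minorFree (⊤ : SimpleGraph (Fin (s + 1))) V G → C V G) :
    HasDefectiveChromaticNumber C s ∧ HasDefectiveChoiceNumber C s ∧
      ∃ δ : ℝ, IsLUB (densities C) δ ∧
        ∃ d : ℕ, (d : ℤ) = ⌊δ * (2 * δ - s + 1)⌋ - s + 1 ∧
          ∀ (V : Type u) [Finite V] (G : SimpleGraph V), C V G → IsChoosable G s d := by
  have hlub := isLUB_csSup
    (s := densities C) ⟨_, PUnit, inferInstance, inferInstance, ⊥,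
      hmf _ _ (minorFree_bot_punit (by omega)), rfl⟩ hC.bddAbove_densities
  set δ := sSup (densities C)
  have hsδ := le_of_mem_upperBounds_densities (by omega) hlub.1 hmf
  have hs' : (2 : ℝ) ≤ s := by exact_mod_cast hs
  -- Since `δ ≥ s - 1`, the factor `2δ - s + 1` is at least `s - 1 ≥ 1`, so the product is at least
  -- `s - 1`.
  obtain ⟨d, hd⟩ : ∃ d : ℕ, (d : ℤ) = ⌊δ * (2 * δ - s + 1)⌋ - s + 1 := by
    apply Int.eq_ofNat_of_zero_le _ |>.imp fun _ => Eq.symm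
    have : (s : ℤ) - 1 ≤ ⌊δ * (2 * δ - s + 1)⌋ := by
      rw [Int.le_floor]
      push_cast
      nlinarith
    linarith
  have hd' : δ * (2 * δ - s + 1) < d + s := by
    have h1 := Int.lt_floor_add_one (δ * (2 * δ - s + 1))
    have h2 : ((⌊δ * (2 * δ - s + 1)⌋ : ℤ) : ℝ) = d + s - 1 := by
      rw [show ⌊δ * (2 * δ - s + 1)⌋ = (d : ℤ) + s - 1 by linarith]
      push_cast
      rfl
    linarith
  have hch : ∀ (V : Type u) [Finite V] (G : SimpleGraph V), C V G → IsChoosable G s d := by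
    intro V _ G hG
    have := Fintype.ofFinite V
    refine isChoosable_of_exists_isReducible (P := C V) (by omega) (fun _ _ h => hC.mono h)
      (fun G hG hbot => ?_) G hG
    by_cases h4 : 4 ≤ s
    · exact hC.exists_isReducible_of_four_le h4 hlub.1 hsδ hd' hG hbot
    · exact hC.exists_isReducible_of_le_three hs (by omega) hG hbot
  obtain ⟨h1, h2⟩ := hasDefectiveNumbers_of_isChoosable hmf hch
  exact ⟨h1, h2, δ, hlub, d, hd, hch⟩

end Choosability

end DefectiveColouring

open DefectiveColouring in
theorem mainTheorem2 (s : ℕ) (hs : 2 ≤ s) :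
    (HasDefectiveChromaticNumber (minorFree.{u} (⊤ : SimpleGraph (Fin (s + 1)))) s ∧
      HasDefectiveChoiceNumber (minorFree.{u} (⊤ : SimpleGraph (Fin (s + 1)))) s ∧
      ∃ δ : ℝ, IsLUB (densities (minorFree.{u} (⊤ : SimpleGraph (Fin (s + 1))))) δ ∧
        ∃ d : ℕ, (d : ℤ) = ⌊δ * (2 * δ - s + 1)⌋ - s + 1 ∧
          ∀ (V : Type u) [Finite V] (G : SimpleGraph V),
            minorFree (⊤ : SimpleGraph (Fin (s + 1))) V G → IsChoosable G s d) ∧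
    (HasDefectiveChromaticNumber (topologicalMinorFree.{u} (⊤ : SimpleGraph (Fin (s + 1)))) s ∧
      HasDefectiveChoiceNumber (topologicalMinorFree.{u} (⊤ : SimpleGraph (Fin (s + 1)))) s ∧
      ∃ δ : ℝ, IsLUB (densities (topologicalMinorFree.{u} (⊤ : SimpleGraph (Fin (s + 1))))) δ ∧
        ∃ d : ℕ, (d : ℤ) = ⌊δ * (2 * δ - s + 1)⌋ - s + 1 ∧
          ∀ (V : Type u) [Finite V] (G : SimpleGraph V),
            topologicalMinorFree (⊤ : SimpleGraph (Fin (s + 1))) V G → IsChoosable G s d) :=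
  ⟨(isSuppressClosed_minorFree (by omega)).hasDefectiveNumbers_and_isChoosable hs
      fun _ _ h => h,
    (isSuppressClosed_topologicalMinorFree (by omega)).hasDefectiveNumbers_and_isChoosable hs
      fun _ _ h h' => h h'.isMinor⟩
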